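/- Let $A\in\mathbb{R}^{n_z\times n_z}$, $B\in\mathbb{R}^{n_z\times n_s}$, $C\in\mathbb{R}^{n_y\times n_z}$, $S\in\mathbb{R}^{n_q\times n_z}$, $N\in\mathbb{R}^{n_z\times n_w}$, $C_p\in\mathbb{R}^{n_{y_p}\times n_z}$, let $\psi\colon\mathbb{R}^{n_q}\to\mathbb{R}^{n_s}$ be Lipschitz with constant $\ell>0$, and let $0<T_1\le T_2$. Given $L\in\mathbb{R}^{n_z\times n_y}$ and $H\in\mathbb{R}^{n_y\times n_y}$, put $\zeta(z,\varepsilon)=\psi(Sz)-\psi(S(z-\varepsilon))$ and $$\mathcal F=\begin{pmatrix}A-LC&L\\ CA-CLC-HC&CL+H\end{pmatrix},\quad \mathcal Q=\begin{pmatrix}B\\CB\end{pmatrix},\quad \mathcal T=\begin{pmatrix}N\\CN\end{pmatrix}.$$ Let $\mathcal H_e$ be the hybrid system with state $x=(z,\varepsilon,\tilde\theta,\tau)\in\mathbb{R}^{2n_z+n_y+1}$, input $u=(w,\eta)\in\mathbb{R}^{n_w}\times\mathbb{R}^{n_y}$ and output $y_p=C_p\varepsilon$, which flows for $\tau\in[0,T_2]$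 according to $$\dot z=Az+B\psi(Sz)+Nw,\quad (\dot\varepsilon,\dot{\tilde\theta})=\mathcal F(\varepsilon,\tilde\theta)+\mathcal Q\zeta(z,\varepsilon)+\mathcal Tw,\quad \dot\tau=-1,$$ and jumps for $\tau=0$ according to $z^+=z$, $\varepsilon^+=\varepsilon$, $\tilde\theta^+=-\eta$, $\tau^+\in[T_1,T_2]$. A solution pair $(\phi,u)$ consists of a hybrid arc $\phi$ (locally absolutely continuous along flows) and a hybrid input $u$ (Lebesgue measurable and, on bounded parts of its domain, essentially bounded along flows) on the same hybrid time domain, with $\phi(0,0)$ in the union of the flow set and the jump set, satisfying these dynamics; it is maximal if it cannot be extended, and complete if its domain is unbounded. Let $\mathcal A=\mathbb{R}^{n_z}\times\{0\}\times\{0\}\times[0,T_2]$, let $|x|_{\mathcal A}$ be the Euclidean distance of $x$ to $\mathcal A$, and let $\|u\|_\infty$ be the maximum of the essential supremum of $|u|$ away from the jump times and the supremum of $|u|$ over the jump times. Let $\lambda_t>0$. Suppose that $P_1\in\mathbb{R}^{n_z\times n_z}$ and $P_2\in\mathbb{R}^{n_y\times n_y}$ are symmetric positive definite, $\delta,\chi>0$,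 $L\in\mathbb{R}^{n_z\times n_y}$ and $H\in\mathbb{R}^{n_y\times n_y}$ are such that the symmetric matrix $$\begin{pmatrix} \operatorname{He}(P_1(A-LC))+2\lambda_tP_1+C_p^{\top}C_p+\chi\ell^2S^{\top}S & P_1L+e^{\delta\tau}(CA-CLC-HC)^{\top}P_2 & P_1B\\ \bullet & e^{\delta\tau}\bigl(\operatorname{He}(P_2(CL+H))+(2\lambda_t-\delta)P_2\bigr) & e^{\delta\tau}P_2CB\\ \bullet&\bullet&-\chi I_{n_s}\end{pmatrix},\qquad \operatorname{He}(X)=X+X^{\top},$$ is negative definite for $\tau=0$ and for $\tau=T_2$. Then there is $\gamma>0$ such that, for these $L$ and $H$: (i) $\mathcal H_e$ is exponentially input-to-state stable with respect to $\mathcal A$, that is, every maximal solution pair is complete, and there are $\kappa,\lambda>0$ and a class-$\mathcal K$ function $\rho$ such that every solution pair $(\phi,u)$ with $\|u\|_\infty<\infty$ satisfies $|\phi(t,j)|_{\mathcal A}\le\max\{\kappa e^{-\lambda(t+j)}|\phi(0,0)|_{\mathcal A},\ \rho(\|u\|_\infty)\}$ for all $(t,j)\in\operatorname{dom}\phi$;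 (ii) there is $\alpha>0$ such that every solution pair $(\phi,u)$ with $\eta\equiv0$ satisfies $$\sqrt{\int_{\mathcal I}|y_p(s,j(s))|^2\,ds}\le\alpha|\phi(0,0)|_{\mathcal A}+\gamma\sqrt{\int_{\mathcal I}|w(s,j(s))|^2\,ds},$$ where $\mathcal I=\{s:(s,j)\in\operatorname{dom}\phi\text{ for some }j\}$ and $j(s)=\min\{j:(s,j)\in\operatorname{dom}\phi\}$ (the right-hand side may be infinite). -/

import Mathlib

open MeasureTheory Set
open scoped ENNReal Matrix

noncomputable section

namespace SporadicObs

/-! ### Euclidean vectors indexed by (sums of) finite types -/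

/-- `ℝ^ι` with the Euclidean norm. -/
abbrev Vec (ι : Type) : Type := EuclideanSpace ℝ ι

/-- The first component of a stacked vector `(a, b)`. -/
def Vec.first {ι κ : Type} (v : Vec (ι ⊕ κ)) : Vec ι :=
  WithLp.toLp 2 (fun i => v (Sum.inl i))

/-- The second component of a stacked vector `(a, b)`. -/
def Vec.second {ι κ : Type} (v : Vec (ι ⊕ κ)) : Vec κ :=
  WithLp.toLp 2 (fun i => v (Sum.inr i))

/-- The stacked vector `(a, b)`. -/
def Vec.stack {ι κ : Type} (a : Vec ι) (b : Vec κ) : Vec (ι ⊕ κ) :=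
  WithLp.toLp 2 (Sum.elim (fun i => a i) (fun i => b i))

/-- Matrix times Euclidean vector. -/
def mulV {ι κ : Type} [Fintype κ] (M : Matrix ι κ ℝ) (v : Vec κ) : Vec ι :=
  WithLp.toLp 2 (M *ᵥ (fun i => v i))

/-! ### Hybrid time domains, hybrid signals -/

/-- `E` is the union of finitely or infinitely many intervals `[t_j, t_{j+1}] × {j}`, where
`0 = t_0 ≤ t_1 ≤ …`; if there is a last interval, it may be of the form `[t_j, T)` with
`T` finite or infinite. -/
def IsHybridTimeDomain (E : Set (ℝ × ℕ)) : Prop :=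
  ∃ t : ℕ → ℝ, t 0 = 0 ∧ Monotone t ∧
    (E = {p | p.1 ∈ Icc (t p.2) (t (p.2 + 1))} ∨
      ∃ (J : ℕ) (last : Set ℝ),
        (last = Icc (t J) (t (J + 1)) ∨ (t J < t (J + 1) ∧ last = Ico (t J) (t (J + 1))) ∨
          last = Ici (t J)) ∧
        E = {p | (p.2 < J ∧ p.1 ∈ Icc (t p.2) (t (p.2 + 1))) ∨ (p.2 = J ∧ p.1 ∈ last)})

/-- A hybrid signal: a function on a hybrid time domain. The values of `val` off `dom` play no
role. -/
structure HybridSignal (V : Type) where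
  dom : Set (ℝ × ℕ)
  isDomain : IsHybridTimeDomain dom
  val : ℝ → ℕ → V

namespace HybridSignal

/-- The interval of ordinary times `t` with `(t, j) ∈ dom`. -/
def slice {V : Type} (φ : HybridSignal V) (j : ℕ) : Set ℝ := {t | (t, j) ∈ φ.dom}

/-- The projection of the domain to ordinary time. -/
def domT {V : Type} (φ : HybridSignal V) : Set ℝ := {t | ∃ j, (t, j) ∈ φ.dom}

/-- `j(t) = min {j | (t, j) ∈ dom}`. -/
def firstIdx {V : Type} (φ : HybridSignal V) (t : ℝ) : ℕ := sInf {j | (t, j) ∈ φ.dom}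

/-- The jump times: `(t, j) ∈ dom` such that `(t, j + 1) ∈ dom`. -/
def jumpSet {V : Type} (φ : HybridSignal V) : Set (ℝ × ℕ) :=
  {p | p ∈ φ.dom ∧ (p.1, p.2 + 1) ∈ φ.dom}

/-- Unbounded domain (domains lie in `[0, ∞) × ℕ`). -/
def IsComplete {V : Type} (φ : HybridSignal V) : Prop :=
  ∀ R : ℝ, ∃ p ∈ φ.dom, R ≤ p.1 + p.2

/-- `φ'` extends `φ`, possibly trivially. -/
def Extends {V : Type} (φ' φ : HybridSignal V) : Prop :=
  φ.dom ⊆ φ'.dom ∧ ∀ t j, (t, j) ∈ φ.dom → φ'.val t j = φ.val t j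

/-- Hybrid input: every `u(·, j)` is Lebesgue measurable and locally essentially bounded, that is,
essentially bounded on every bounded part of its domain. -/
def IsHybridInput {ι : Type} [Fintype ι] (u : HybridSignal (Vec ι)) : Prop :=
  ∀ j, AEMeasurable (fun t => u.val t j) (volume.restrict (u.slice j)) ∧
    ∀ R : ℝ, ∃ M : ℝ, ∀ᵐ t ∂(volume.restrict (u.slice j ∩ Iic R)), ‖u.val t j‖ ≤ M

/-- Hybrid arc: every `φ(·, j)` is locally absolutely continuous. -/
def IsHybridArc {ι : Type} [Fintype ι] (φ : HybridSignal (Vec ι)) : Prop :=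
  ∀ j, ∀ a b : ℝ, a ≤ b → Icc a b ⊆ φ.slice j →
    AbsolutelyContinuousOnInterval (fun t => φ.val t j) a b

/-- The `T`-truncated `L_∞` norm (with values in `[0, ∞]`): the maximum of the essential supremum
away from the jump times and of the supremum over the jump times. -/
def linftyTrunc {ι : Type} [Fintype ι] (u : HybridSignal (Vec ι)) (T : ℝ) : ℝ≥0∞ :=
  max
    (⨆ k : ℕ, essSup (fun s => ‖u.val s k‖ₑ)
      (volume.restrict {s | (s, k) ∈ u.dom \ u.jumpSet ∧ s + k ≤ T}))
    (⨆ p ∈ {p : ℝ × ℕ | p ∈ u.jumpSet ∧ p.1 + p.2 ≤ T}, ‖u.val p.1 p.2‖ₑ)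

/-- The `L_∞` norm: the limit, that is, the supremum, of the truncated norms, which are
nondecreasing in `T`. -/
def linfty {ι : Type} [Fintype ι] (u : HybridSignal (Vec ι)) : ℝ≥0∞ :=
  ⨆ T : ℝ, u.linftyTrunc T

end HybridSignal

/-! ### Hybrid systems with inputs -/

/-- Data of a hybrid system with state in `ℝ^ι`, flow input `w ∈ ℝ^κ` and jump input `η ∈ ℝ^μ`:
`ẋ = f(x, w)` for `x ∈ C`, `x⁺ ∈ G(x, η)` for `x ∈ D`. -/
structure HybridSystem (ι κ μ : Type) where
  flowSet : Set (Vec ι)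
  flowMap : Vec ι → Vec κ → Vec ι
  jumpSet : Set (Vec ι)
  jumpMap : Vec ι → Vec μ → Set (Vec ι)

namespace HybridSystem

variable {ι κ μ : Type} [Fintype ι] [Fintype κ] [Fintype μ]

/-- `(φ, u)` with `u = (w, η)` is a solution pair. -/
structure IsSolutionPair (S : HybridSystem ι κ μ) (φ : HybridSignal (Vec ι))
    (u : HybridSignal (Vec (κ ⊕ μ))) : Prop where
  arc : φ.IsHybridArc
  input : u.IsHybridInput
  dom_eq : φ.dom = u.dom
  init : φ.val 0 0 ∈ closure S.flowSet ∪ S.jumpSet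
  flow_mem : ∀ j, ∀ t ∈ interior (φ.slice j), φ.val t j ∈ S.flowSet
  flow_deriv : ∀ j, ∀ᵐ t ∂(volume.restrict (φ.slice j)),
    HasDerivAt (fun s => φ.val s j) (S.flowMap (φ.val t j) (u.val t j).first) t
  jump : ∀ p ∈ φ.jumpSet, φ.val p.1 p.2 ∈ S.jumpSet ∧
    φ.val p.1 (p.2 + 1) ∈ S.jumpMap (φ.val p.1 p.2) (u.val p.1 p.2).second

/-- A solution pair that cannot be extended. -/
def IsMaximalPair (S : HybridSystem ι κ μ) (φ : HybridSignal (Vec ι))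
    (u : HybridSignal (Vec (κ ⊕ μ))) : Prop :=
  S.IsSolutionPair φ u ∧
    ∀ φ' u', S.IsSolutionPair φ' u' → φ'.Extends φ → u'.Extends u → φ'.dom = φ.dom

end HybridSystem

/-- Class `K`: continuous, strictly increasing on `[0, ∞)`, zero at zero. -/
def IsClassK (ρ : ℝ → ℝ) : Prop :=
  ContinuousOn ρ (Ici 0) ∧ StrictMonoOn ρ (Ici 0) ∧ ρ 0 = 0

namespace HybridSystem

variable {ι κ μ : Type} [Fintype ι] [Fintype κ] [Fintype μ]

/-- Pre-exponential input-to-state stability with respect to `A`. -/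
def IsPreEISS (S : HybridSystem ι κ μ) (A : Set (Vec ι)) : Prop :=
  ∃ k > (0 : ℝ), ∃ lam > (0 : ℝ), ∃ ρ : ℝ → ℝ, IsClassK ρ ∧
    ∀ φ u, S.IsSolutionPair φ u → u.linfty < ⊤ →
      ∀ t j, (t, j) ∈ φ.dom →
        Metric.infDist (φ.val t j) A ≤
          max (k * Real.exp (-lam * (t + j)) * Metric.infDist (φ.val 0 0) A)
            (ρ u.linfty.toReal)

/-- Exponential input-to-state stability (eISS) with respect to `A`: pre-exponential
input-to-state stability, and every maximal solution pair is complete. -/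
def IsEISS (S : HybridSystem ι κ μ) (A : Set (Vec ι)) : Prop :=
  S.IsPreEISS A ∧ ∀ φ u, S.IsMaximalPair φ u → φ.IsComplete

end HybridSystem

/-! ### Plant, observer error dynamics -/

/-- Data of the plant `ż = A z + B ψ(S z) + N w`, `y = C z + η`, with performance output
`y_p = C_p (z - ẑ)`. -/
structure Plant (nz ny nw nq ns np : ℕ) where
  A : Matrix (Fin nz) (Fin nz) ℝ
  B : Matrix (Fin nz) (Fin ns) ℝ
  C : Matrix (Fin ny) (Fin nz) ℝ
  S : Matrix (Fin nq) (Fin nz) ℝ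
  N : Matrix (Fin nz) (Fin nw) ℝ
  Cp : Matrix (Fin np) (Fin nz) ℝ
  ψ : Vec (Fin nq) → Vec (Fin ns)

/-- Index type of the state `x = (z, (ε, θ̃), τ) ∈ ℝ^(2 n_z + n_y + 1)`. -/
abbrev StateIdx (nz ny : ℕ) : Type := Fin nz ⊕ ((Fin nz ⊕ Fin ny) ⊕ Fin 1)

section State

variable {nz ny : ℕ}

/-- The plant state `z`. -/
def zPart (x : Vec (StateIdx nz ny)) : Vec (Fin nz) := x.first

/-- The pair `(ε, θ̃)`. -/
def errPart (x : Vec (StateIdx nz ny)) : Vec (Fin nz ⊕ Fin ny) := x.second.first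

/-- The timer `τ`. -/
def timer (x : Vec (StateIdx nz ny)) : ℝ := x.second.second 0

/-- The state `(z, (ε, θ̃), τ)`. -/
def mkState (z : Vec (Fin nz)) (e : Vec (Fin nz ⊕ Fin ny)) (τ : ℝ) : Vec (StateIdx nz ny) :=
  Vec.stack z (Vec.stack e (WithLp.toLp 2 fun _ => τ))

end State

namespace Plant

variable {nz ny nw nq ns np : ℕ} (P : Plant nz ny nw nq ns np)

/-- `ζ(v₁, v₂) = ψ(S v₁) - ψ(S (v₁ - v₂))`. -/
def zeta (v₁ v₂ : Vec (Fin nz)) : Vec (Fin ns) :=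
  P.ψ (mulV P.S v₁) - P.ψ (mulV P.S (v₁ - v₂))

/-- The matrix `𝓕`. -/
def calF (L : Matrix (Fin nz) (Fin ny) ℝ) (H : Matrix (Fin ny) (Fin ny) ℝ) :
    Matrix (Fin nz ⊕ Fin ny) (Fin nz ⊕ Fin ny) ℝ :=
  Matrix.fromBlocks (P.A - L * P.C) L
    (P.C * P.A - P.C * L * P.C - H * P.C) (P.C * L + H)

/-- The matrix `𝓣`. -/
def calT : Matrix (Fin nz ⊕ Fin ny) (Fin nw) ℝ := Matrix.fromRows P.N (P.C * P.N)

/-- The matrix `𝓠`. -/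
def calQ : Matrix (Fin nz ⊕ Fin ny) (Fin ns) ℝ := Matrix.fromRows P.B (P.C * P.B)

/-- The matrix `𝓖`. -/
def calG (nz ny : ℕ) : Matrix (Fin nz ⊕ Fin ny) (Fin nz ⊕ Fin ny) ℝ :=
  Matrix.fromBlocks 1 0 0 0

/-- The matrix `𝓝`. -/
def calN (nz ny : ℕ) : Matrix (Fin nz ⊕ Fin ny) (Fin ny) ℝ := Matrix.fromRows 0 (-1)

/-- The hybrid system `𝓗_e` of plant, estimation error and timer. -/
def errorSystem (L : Matrix (Fin nz) (Fin ny) ℝ) (H : Matrix (Fin ny) (Fin ny) ℝ) (T₁ T₂ : ℝ) :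
    HybridSystem (StateIdx nz ny) (Fin nw) (Fin ny) where
  flowSet := {x | timer x ∈ Icc 0 T₂}
  flowMap := fun x w =>
    mkState
      (mulV P.A (zPart x) + mulV P.B (P.ψ (mulV P.S (zPart x))) + mulV P.N w)
      (mulV (P.calF L H) (errPart x) + mulV P.calQ (P.zeta (zPart x) (errPart x).first)
        + mulV P.calT w)
      (-1)
  jumpSet := {x | timer x = 0}
  jumpMap := fun x η =>
    {g | ∃ v ∈ Icc T₁ T₂,
      g = mkState (zPart x) (mulV (calG nz ny) (errPart x) + mulV (calN nz ny) η) v}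

/-- The set `ℝ^{n_z} × {0} × {0} × [0, T₂]`. -/
def attractor (nz ny : ℕ) (T₂ : ℝ) : Set (Vec (StateIdx nz ny)) :=
  {x | errPart x = 0 ∧ timer x ∈ Icc 0 T₂}

/-- The performance output `y_p = C_p ε`. -/
def perfOutput (x : Vec (StateIdx nz ny)) : Vec (Fin np) := mulV P.Cp (errPart x).first

/-- The bound on the `L₂` gain from `w` to `y_p` by `γ`: there is `α > 0` such that every solution
pair with `η ≡ 0` satisfies `‖y_p‖₂ ≤ α |φ(0,0)|_𝓐 + γ ‖w‖₂`, the `L₂` norms (with values in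
`[0, ∞]`) being taken over the ordinary times in the domain of the solution. -/
def HasL2Gain (L : Matrix (Fin nz) (Fin ny) ℝ) (H : Matrix (Fin ny) (Fin ny) ℝ) (T₁ T₂ γ : ℝ) :
    Prop :=
  ∃ α > (0 : ℝ), ∀ φ u, (P.errorSystem L H T₁ T₂).IsSolutionPair φ u →
    (∀ t j, (t, j) ∈ u.dom → (u.val t j).second = 0) →
    (∫⁻ s in φ.domT, ‖P.perfOutput (φ.val s (φ.firstIdx s))‖ₑ ^ 2) ^ (1 / 2 : ℝ) ≤
      ENNReal.ofReal (α * Metric.infDist (φ.val 0 0) (attractor nz ny T₂)) +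
        ENNReal.ofReal γ *
          (∫⁻ s in u.domT, ‖(u.val s (u.firstIdx s)).first‖ₑ ^ 2) ^ (1 / 2 : ℝ)

/-! ### The matrix inequality -/

/-- `He(M) = M + Mᵀ`. -/
def He {n : ℕ} (M : Matrix (Fin n) (Fin n) ℝ) : Matrix (Fin n) (Fin n) ℝ := M + Mᵀ

/-- The symmetric matrix `𝓜(τ)`, with blocks indexed by `(ε, θ̃, w, ζ)`. -/
def calM (lamt ell γ : ℝ) (P₁ : Matrix (Fin nz) (Fin nz) ℝ) (P₂ : Matrix (Fin ny) (Fin ny) ℝ)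
    (δ χ : ℝ) (L : Matrix (Fin nz) (Fin ny) ℝ) (H : Matrix (Fin ny) (Fin ny) ℝ) (τ : ℝ) :
    Matrix (Fin nz ⊕ (Fin ny ⊕ (Fin nw ⊕ Fin ns))) (Fin nz ⊕ (Fin ny ⊕ (Fin nw ⊕ Fin ns))) ℝ :=
  let M₁₁ : Matrix (Fin nz) (Fin nz) ℝ :=
    He (P₁ * (P.A - L * P.C)) + (2 * lamt) • P₁ + P.Cpᵀ * P.Cp + (χ * ell ^ 2) • (P.Sᵀ * P.S)
  let M₁₂ : Matrix (Fin nz) (Fin ny) ℝ :=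
    P₁ * L + Real.exp (δ * τ) • ((P.C * P.A - P.C * L * P.C - H * P.C)ᵀ * P₂)
  let M₁₃ : Matrix (Fin nz) (Fin nw) ℝ := P₁ * P.N
  let M₁₄ : Matrix (Fin nz) (Fin ns) ℝ := P₁ * P.B
  let M₂₂ : Matrix (Fin ny) (Fin ny) ℝ :=
    Real.exp (δ * τ) • (He (P₂ * (P.C * L + H)) + (2 * lamt - δ) • P₂)
  let M₂₃ : Matrix (Fin ny) (Fin nw) ℝ := Real.exp (δ * τ) • (P₂ * P.C * P.N)
  let M₂₄ : Matrix (Fin ny) (Fin ns) ℝ := Real.exp (δ * τ) • (P₂ * P.C * P.B)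
  let M₃₃ : Matrix (Fin nw) (Fin nw) ℝ := (-γ ^ 2) • (1 : Matrix (Fin nw) (Fin nw) ℝ)
  let M₄₄ : Matrix (Fin ns) (Fin ns) ℝ := (-χ) • (1 : Matrix (Fin ns) (Fin ns) ℝ)
  Matrix.fromBlocks
    M₁₁ (Matrix.fromCols M₁₂ (Matrix.fromCols M₁₃ M₁₄))
    (Matrix.fromRows M₁₂ᵀ (Matrix.fromRows M₁₃ᵀ M₁₄ᵀ))
    (Matrix.fromBlocks
      M₂₂ (Matrix.fromCols M₂₃ M₂₄)
      (Matrix.fromRows M₂₃ᵀ M₂₄ᵀ)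
      (Matrix.fromBlocks M₃₃ 0 0 M₄₄))

/-- The inclusion of the indices `(ε, θ̃, ζ)` into `(ε, θ̃, w, ζ)`. -/
def keepIdx (nz ny nw ns : ℕ) :
    Fin nz ⊕ (Fin ny ⊕ Fin ns) → Fin nz ⊕ (Fin ny ⊕ (Fin nw ⊕ Fin ns)) :=
  Sum.map id (Sum.map id Sum.inr)

/-- `𝓜(τ)` with the row and the column of blocks of `w` removed. It does not depend on `γ`, as
`calM_submatrix` shows, so `γ` is set to `0` here. -/
def calMred (lamt ell : ℝ) (P₁ : Matrix (Fin nz) (Fin nz) ℝ) (P₂ : Matrix (Fin ny) (Fin ny) ℝ)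
    (δ χ : ℝ) (L : Matrix (Fin nz) (Fin ny) ℝ) (H : Matrix (Fin ny) (Fin ny) ℝ) (τ : ℝ) :
    Matrix (Fin nz ⊕ (Fin ny ⊕ Fin ns)) (Fin nz ⊕ (Fin ny ⊕ Fin ns)) ℝ :=
  (P.calM lamt ell 0 P₁ P₂ δ χ L H τ).submatrix (keepIdx nz ny nw ns) (keepIdx nz ny nw ns)

theorem calM_submatrix (lamt ell γ : ℝ) (P₁ : Matrix (Fin nz) (Fin nz) ℝ)
    (P₂ : Matrix (Fin ny) (Fin ny) ℝ) (δ χ : ℝ) (L : Matrix (Fin nz) (Fin ny) ℝ)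
    (H : Matrix (Fin ny) (Fin ny) ℝ) (τ : ℝ) :
    (P.calM lamt ell γ P₁ P₂ δ χ L H τ).submatrix (keepIdx nz ny nw ns) (keepIdx nz ny nw ns)
      = P.calMred lamt ell P₁ P₂ δ χ L H τ := by
  ext i j
  rcases i with i | i | i <;> rcases j with j | j | j <;> rfl

end Plant

end SporadicObs

end

/-
The matrix inequality is the decay of `V = εᵀ P₁ ε + e^{δτ} θ̃ᵀ P₂ θ̃` along the flow without `w`.
The quadratic form is affine in `e^{δτ}`, so negativity at `τ = 0` and `τ = T₂` gives negativity in
between, with a margin that absorbs `w` by Young's inequality and leaves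
`V̇ ≤ -2 λ_t V - |y_p|² + γ² |w|²`. A jump replaces `θ̃` by `-η`, so it adds at most a multiple of
`|η|²` to `V`. Successive jumps are at least `T₁` apart, so decay in `t` is decay in `t + j` and the
jump contributions sum like a geometric series; this is the input-to-state estimate. Integrating
the dissipation inequality instead, with `η = 0`, gives the `L²` gain. Maximal solution pairs are
complete because the flow map is globally Lipschitz, so that a bounded last interval can always be
continued by flowing or jumping.
-/

namespace SporadicObs

section AbsolutelyContinuous

open AbsolutelyContinuousOnInterval

variable {X Y E F : Type*} [PseudoMetricSpace X] [PseudoMetricSpace Y]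
  [NormedAddCommGroup E] [NormedAddCommGroup F] {a b c d : ℝ}

theorem absolutelyContinuousOnInterval_congr {f g : ℝ → X}
    (hf : AbsolutelyContinuousOnInterval f a b) (h : EqOn f g (uIcc a b)) :
    AbsolutelyContinuousOnInterval g a b := by
  rw [absolutelyContinuousOnInterval_iff] at hf ⊢
  intro ε hε
  obtain ⟨η, hη, hsum⟩ := hf ε hε
  refine ⟨η, hη, fun I hI hl => lt_of_eq_of_lt ?_ (hsum I hI hl)⟩
  exact Finset.sum_congr rfl fun i hi => by rw [h (hI.1 i hi).1, h (hI.1 i hi).2]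

theorem absolutelyContinuousOnInterval_lipschitzOnWith_comp {f : ℝ → X} {g : X → Y} {K : NNReal}
    {s : Set X} (hg : LipschitzOnWith K g s) (hs : MapsTo f (uIcc a b) s)
    (hf : AbsolutelyContinuousOnInterval f a b) :
    AbsolutelyContinuousOnInterval (fun t => g (f t)) a b := by
  rw [absolutelyContinuousOnInterval_iff] at hf ⊢
  intro ε hε
  obtain ⟨η, hη, hsum⟩ := hf (ε / (K + 1)) (by positivity)
  refine ⟨η, hη, fun I hI hl => ?_⟩
  calc ∑ i ∈ Finset.range I.1, dist (g (f (I.2 i).1)) (g (f (I.2 i).2))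
      ≤ ∑ i ∈ Finset.range I.1, K * dist (f (I.2 i).1) (f (I.2 i).2) :=
        Finset.sum_le_sum fun i hi =>
          hg.dist_le_mul _ (hs (hI.1 i hi).1) _ (hs (hI.1 i hi).2)
    _ = K * ∑ i ∈ Finset.range I.1, dist (f (I.2 i).1) (f (I.2 i).2) := by
        rw [Finset.mul_sum]
    _ ≤ K * (ε / (K + 1)) := by gcongr; exact (hsum I hI hl).le
    _ < ε := by
        rw [mul_div_assoc', div_lt_iff₀ (by positivity)]
        nlinarith [K.coe_nonneg]

theorem absolutelyContinuousOnInterval_contDiff_comp [NormedSpace ℝ E] [FiniteDimensional ℝ E]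
    [NormedSpace ℝ F] {f : ℝ → E} {g : E → F} (hg : ContDiff ℝ 1 g)
    (hf : AbsolutelyContinuousOnInterval f a b) :
    AbsolutelyContinuousOnInterval (fun t => g (f t)) a b := by
  obtain ⟨R, hR⟩ := hf.exists_bound
  obtain ⟨K, hK⟩ := hg.contDiffOn.exists_lipschitzOnWith (by decide)
    (convex_closedBall (0 : E) R) (isCompact_closedBall (0 : E) R)
  exact absolutelyContinuousOnInterval_lipschitzOnWith_comp hK
    (fun t ht => by simpa using hR t ht) hf

theorem absolutelyContinuousOnInterval_comp_monotone {f : ℝ → X} {p : ℝ → ℝ}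
    (hp : Monotone p) (hlip : LipschitzWith 1 p) (hmaps : MapsTo p (uIcc a b) (uIcc c d))
    (hf : AbsolutelyContinuousOnInterval f c d) :
    AbsolutelyContinuousOnInterval (fun t => f (p t)) a b := by
  rw [absolutelyContinuousOnInterval_iff] at hf ⊢
  intro ε hε
  obtain ⟨η, hη, hsum⟩ := hf ε hε
  have hdisj : ∀ {x y x' y' : ℝ}, Disjoint (uIoc x y) (uIoc x' y') →
      Disjoint (uIoc (p x) (p y)) (uIoc (p x') (p y')) := fun h => by
    simp only [uIoc, Ioc_disjoint_Ioc, ← hp.map_min, ← hp.map_max] at h ⊢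
    exact hp h
  refine ⟨η, hη, fun I hI hl => hsum (I.1, fun i => (p (I.2 i).1, p (I.2 i).2)) ⟨?_, ?_⟩ ?_⟩
  · exact fun i hi => ⟨hmaps (hI.1 i hi).1, hmaps (hI.1 i hi).2⟩
  · exact fun i hi j hj hij => hdisj (hI.2 hi hj hij)
  · refine (Finset.sum_le_sum fun i _ => ?_).trans_lt hl
    simpa using hlip.dist_le_mul (I.2 i).1 (I.2 i).2

theorem absolutelyContinuousOnInterval_trans {f : ℝ → E} (hab : a ≤ b) (hbc : b ≤ c)
    (hf : AbsolutelyContinuousOnInterval f a b) (hf' : AbsolutelyContinuousOnInterval f b c) :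
    AbsolutelyContinuousOnInterval f a c := by
  have hmin : MapsTo (fun t => min t b) (uIcc a c) (uIcc a b) := fun t ht => by
    rw [uIcc_of_le (hab.trans hbc)] at ht
    rw [uIcc_of_le hab]
    exact ⟨le_min ht.1 hab, min_le_right _ _⟩
  have hmax : MapsTo (fun t => max t b) (uIcc a c) (uIcc b c) := fun t ht => by
    rw [uIcc_of_le (hab.trans hbc)] at ht
    rw [uIcc_of_le hbc]
    exact ⟨le_max_right _ _, max_le ht.2 hbc⟩
  have hleft := absolutelyContinuousOnInterval_comp_monotone (fun _ _ h => min_le_min_right b h)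
    (LipschitzWith.id.min_const b) hmin hf
  have hright := absolutelyContinuousOnInterval_comp_monotone (fun _ _ h => max_le_max_right b h)
    (LipschitzWith.id.max_const b) hmax hf'
  have hconst : AbsolutelyContinuousOnInterval (fun _ : ℝ => f b) a c :=
    (LipschitzWith.const (f b)).lipschitzOnWith.absolutelyContinuousOnInterval
  refine absolutelyContinuousOnInterval_congr ((hleft.fun_add hright).fun_sub hconst) fun t _ => ?_
  rcases le_total t b with h | h <;> simp [h]

theorem sub_le_integral_of_ae_hasDerivAt_le {f f' h : ℝ → ℝ} (hab : a ≤ b)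
    (hf : AbsolutelyContinuousOnInterval f a b)
    (hd : ∀ᵐ t ∂(volume.restrict (Icc a b)), HasDerivAt f (f' t) t ∧ f' t ≤ h t)
    (hh : IntegrableOn h (Icc a b)) : f b - f a ≤ ∫ t in Icc a b, h t := by
  rw [← hf.integral_deriv_eq_sub, intervalIntegral.integral_of_le hab,
    ← integral_Icc_eq_integral_Ioc]
  refine integral_mono_ae ?_ hh ?_
  · exact (intervalIntegrable_iff_integrableOn_Icc_of_le hab).1 hf.intervalIntegrable_deriv
  · filter_upwards [hd] with t ht
    exact ht.1.deriv.trans_le ht.2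

theorem sub_le_mul_of_ae_hasDerivAt_le {f f' : ℝ → ℝ} {D : ℝ} (hab : a ≤ b)
    (hf : AbsolutelyContinuousOnInterval f a b)
    (hd : ∀ᵐ t ∂(volume.restrict (Icc a b)), HasDerivAt f (f' t) t ∧ f' t ≤ D) :
    f b - f a ≤ D * (b - a) := by
  have h := sub_le_integral_of_ae_hasDerivAt_le hab hf hd continuous_const.integrableOn_Icc
  rwa [setIntegral_const, Real.volume_real_Icc_of_le hab, smul_eq_mul, mul_comm] at h

theorem eq_add_mul_of_ae_hasDerivAt_const {f : ℝ → ℝ} {D : ℝ} (hab : a ≤ b)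
    (hf : AbsolutelyContinuousOnInterval f a b)
    (hd : ∀ᵐ t ∂(volume.restrict (Icc a b)), HasDerivAt f D t) : f b = f a + D * (b - a) := by
  have hle := sub_le_mul_of_ae_hasDerivAt_le hab hf (hd.mono fun t ht => ⟨ht, le_rfl⟩)
  have hge := sub_le_mul_of_ae_hasDerivAt_le hab hf.fun_neg
    (hd.mono fun t ht => ⟨ht.neg, le_rfl⟩)
  linarith

theorem le_exp_mul_of_ae_hasDerivAt_le {f f' : ℝ → ℝ} {k : ℝ} (hab : a ≤ b)
    (hf : AbsolutelyContinuousOnInterval f a b)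
    (hd : ∀ᵐ t ∂(volume.restrict (Icc a b)), HasDerivAt f (f' t) t ∧ f' t ≤ k * f t) :
    f b ≤ Real.exp (k * (b - a)) * f a := by
  have hexp : ContDiff ℝ 1 fun t : ℝ => Real.exp (-k * t) := by fun_prop
  have hac : AbsolutelyContinuousOnInterval (fun t => Real.exp (-k * t) * f t) a b :=
    (ContDiffOn.absolutelyContinuousOnInterval hexp.contDiffOn).fun_mul hf
  have hle : Real.exp (-k * b) * f b - Real.exp (-k * a) * f a ≤ 0 * (b - a) := by
    refine sub_le_mul_of_ae_hasDerivAt_le hab hac (hd.mono fun t ht => ⟨?_, ?_⟩)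
      (f' := fun t => Real.exp (-k * t) * -k * f t + Real.exp (-k * t) * f' t)
    · have : HasDerivAt (fun t : ℝ => Real.exp (-k * t)) (Real.exp (-k * t) * -k) t := by
        simpa using ((hasDerivAt_id t).const_mul (-k)).exp
      exact this.mul ht.1
    · nlinarith [mul_le_mul_of_nonneg_left ht.2 (Real.exp_pos (-k * t)).le]
  calc f b = Real.exp (k * b) * (Real.exp (-k * b) * f b) := by
        rw [← mul_assoc, ← Real.exp_add]; simp
    _ ≤ Real.exp (k * b) * (Real.exp (-k * a) * f a) :=
        mul_le_mul_of_nonneg_left (by linarith) (Real.exp_pos _).le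
    _ = Real.exp (k * (b - a)) * f a := by
        rw [← mul_assoc, ← Real.exp_add]; ring_nf

theorem norm_sub_le_of_ae_norm_hasDerivAt_le {E : Type*} [NormedAddCommGroup E]
    [InnerProductSpace ℝ E] [FiniteDimensional ℝ E] {f f' : ℝ → E} {D : ℝ} (hab : a ≤ b)
    (hf : AbsolutelyContinuousOnInterval f a b)
    (hd : ∀ᵐ t ∂(volume.restrict (Icc a b)), HasDerivAt f (f' t) t ∧ ‖f' t‖ ≤ D) :
    ‖f b - f a‖ ≤ D * (b - a) := by
  set v := f b - f a with hv
  have hinner : inner ℝ v (f b) - inner ℝ v (f a) ≤ ‖v‖ * D * (b - a) := by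
    refine sub_le_mul_of_ae_hasDerivAt_le hab (f' := fun t => inner ℝ v (f' t))
      (absolutelyContinuousOnInterval_contDiff_comp (innerSL ℝ v).contDiff hf)
      (hd.mono fun t ht => ⟨(innerSL ℝ v).hasFDerivAt.comp_hasDerivAt t ht.1, ?_⟩)
    exact (real_inner_le_norm _ _).trans (by gcongr; exact ht.2)
  rw [← inner_sub_right, ← hv, real_inner_self_eq_norm_mul_norm, mul_assoc] at hinner
  rcases hab.eq_or_lt with rfl | hlt
  · simp [hv]
  rcases (norm_nonneg v).eq_or_lt with h0 | h0
  · rw [← h0]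
    have : (ae (volume.restrict (Icc a b))).NeBot :=
      ae_neBot.2 (by simp [Measure.restrict_eq_zero, hlt])
    obtain ⟨t, ht⟩ := hd.exists
    exact mul_nonneg ((norm_nonneg _).trans ht.2) (sub_nonneg.2 hab)
  · exact le_of_mul_le_mul_left hinner h0

end AbsolutelyContinuous

theorem two_mul_mul_mul_le {m : ℝ} (hm : 0 < m) (c a b : ℝ) :
    2 * (c * (a * b)) ≤ m * a ^ 2 + c ^ 2 / m * b ^ 2 := by
  have hsq : m * a ^ 2 + c ^ 2 / m * b ^ 2 - 2 * (c * (a * b)) = (m * a - c * b) ^ 2 / m := by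
    field_simp
    ring
  have hnonneg : 0 ≤ (m * a - c * b) ^ 2 / m := by positivity
  linarith

/-- `t` lists the initial times of the intervals that make up the hybrid time domain `E`. If `E`
has a last interval, with index `J`, then the values `t j` with `J < j` carry no information. -/
structure IsStartTimes (E : Set (ℝ × ℕ)) (t : ℕ → ℝ) : Prop where
  zero : t 0 = 0
  mono : Monotone t
  zero_mem : ((0 : ℝ), 0) ∈ E
  start_le : ∀ {s : ℝ} {j : ℕ}, (s, j) ∈ E → t j ≤ s
  mem_of_le : ∀ {s r : ℝ} {j : ℕ}, (s, j) ∈ E → t j ≤ r → r ≤ s → (r, j) ∈ E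
  end_mem : ∀ {s : ℝ} {j : ℕ}, (s, j + 1) ∈ E → (t (j + 1), j) ∈ E
  le_end : ∀ {s s' : ℝ} {j : ℕ}, (s, j) ∈ E → (s', j + 1) ∈ E → s ≤ t (j + 1)

/-- The hybrid time domain with start times `t` whose last interval `last` has index `J`. -/
def cutDomain (t : ℕ → ℝ) (J : ℕ) (last : Set ℝ) : Set (ℝ × ℕ) :=
  {p | (p.2 < J ∧ p.1 ∈ Icc (t p.2) (t (p.2 + 1))) ∨ (p.2 = J ∧ p.1 ∈ last)}

section CutDomain

variable {t : ℕ → ℝ} {J j : ℕ} {last : Set ℝ} {s : ℝ}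

theorem mem_cutDomain_of_lt (h : j < J) :
    (s, j) ∈ cutDomain t J last ↔ s ∈ Icc (t j) (t (j + 1)) := by
  simp [cutDomain, h, h.ne]

theorem mem_cutDomain_self : (s, J) ∈ cutDomain t J last ↔ s ∈ last := by
  simp [cutDomain]

theorem le_of_mem_cutDomain (h : (s, j) ∈ cutDomain t J last) : j ≤ J :=
  h.elim (fun h => h.1.le) fun h => h.1.le

theorem isHybridTimeDomain_cutDomain (h0 : t 0 = 0) (hm : Monotone t) {b : ℝ} (hb : t J ≤ b) :
    IsHybridTimeDomain (cutDomain t J (Icc (t J) b)) := by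
  refine ⟨fun k => if k ≤ J then t k else b, by simp [h0], ?_, Or.inr ⟨J, Icc (t J) b, ?_, ?_⟩⟩
  · intro i k hik
    simp only
    split_ifs with h1 h2 h2
    · exact hm hik
    · exact (hm h1).trans hb
    · omega
    · exact le_rfl
  · left
    simp
  · ext ⟨s, j⟩
    simp only [cutDomain, mem_ofPred_eq]
    refine or_congr (and_congr_right fun h => ?_) Iff.rfl
    rw [if_pos h.le, if_pos (Nat.succ_le_of_lt h)]

theorem isStartTimes_cutDomain (h0 : t 0 = 0) (hm : Monotone t) (hJ : t J ∈ last)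
    (hlast : ∀ s ∈ last, t J ≤ s ∧ Icc (t J) s ⊆ last) : IsStartTimes (cutDomain t J last) t where
  zero := h0
  mono := hm
  zero_mem := by
    rcases Nat.eq_zero_or_pos J with rfl | h
    · exact mem_cutDomain_self.2 (h0 ▸ hJ)
    · exact (mem_cutDomain_of_lt h).2 ⟨h0.le, h0 ▸ hm (Nat.zero_le 1)⟩
  start_le {s j} h := by
    rcases (le_of_mem_cutDomain h).lt_or_eq with hj | rfl
    · exact ((mem_cutDomain_of_lt hj).1 h).1
    · exact (hlast s (mem_cutDomain_self.1 h)).1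
  mem_of_le {s r j} h h1 h2 := by
    rcases (le_of_mem_cutDomain h).lt_or_eq with hj | rfl
    · exact (mem_cutDomain_of_lt hj).2 ⟨h1, h2.trans ((mem_cutDomain_of_lt hj).1 h).2⟩
    · exact mem_cutDomain_self.2 ((hlast s (mem_cutDomain_self.1 h)).2 ⟨h1, h2⟩)
  end_mem h := (mem_cutDomain_of_lt (le_of_mem_cutDomain h)).2 ⟨hm (Nat.le_succ _), le_rfl⟩
  le_end h h' := ((mem_cutDomain_of_lt (le_of_mem_cutDomain h')).1 h).2

end CutDomain

theorem IsHybridTimeDomain.exists_isStartTimes {E : Set (ℝ × ℕ)} (hE : IsHybridTimeDomain E) :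
    ∃ t, IsStartTimes E t := by
  obtain ⟨t, h0, hm, rfl | ⟨J, last, hl, rfl⟩⟩ := hE
  · exact ⟨t, h0, hm, ⟨h0.le, h0 ▸ hm (Nat.zero_le 1)⟩, fun h => h.1,
      fun h h1 h2 => ⟨h1, h2.trans h.2⟩, fun {_ j} _ => ⟨hm (Nat.le_succ j), le_rfl⟩,
      fun h _ => h.2⟩
  · refine ⟨t, isStartTimes_cutDomain h0 hm ?_ ?_⟩ <;> rcases hl with rfl | ⟨h, rfl⟩ | rfl
    · exact left_mem_Icc.2 (hm (Nat.le_succ J))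
    · exact left_mem_Ico.2 h
    · exact self_mem_Ici
    · exact fun s hs => ⟨hs.1, Icc_subset_Icc_right hs.2⟩
    · exact fun s hs => ⟨hs.1, fun r hr => ⟨hr.1, hr.2.trans_lt hs.2⟩⟩
    · exact fun s hs => ⟨hs, Icc_subset_Ici_self⟩

theorem HybridSignal.exists_dom_eq_cutDomain {V : Type} {φ : HybridSignal V}
    (h : ¬ φ.IsComplete) :
    ∃ (t : ℕ → ℝ) (J : ℕ) (last : Set ℝ), t 0 = 0 ∧ Monotone t ∧ φ.dom = cutDomain t J last ∧
      (last = Icc (t J) (t (J + 1)) ∨ (t J < t (J + 1) ∧ last = Ico (t J) (t (J + 1)))) := by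
  obtain ⟨t, h0, hm, hE | ⟨J, last, hl | hl | rfl, hE⟩⟩ := φ.isDomain
  · refine absurd (fun R => ?_) h
    obtain ⟨n, hn⟩ := exists_nat_ge R
    refine ⟨(t n, n), hE ▸ ⟨le_rfl, hm (Nat.le_succ n)⟩, hn.trans ?_⟩
    exact le_add_of_nonneg_left (h0 ▸ hm (Nat.zero_le n))
  · exact ⟨t, J, last, h0, hm, hE, Or.inl hl⟩
  · exact ⟨t, J, last, h0, hm, hE, Or.inr hl⟩
  · refine absurd (fun R => ⟨(max R (t J), J), hE ▸ Or.inr ⟨rfl, le_max_right R (t J)⟩, ?_⟩) h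
    exact (le_max_left R (t J)).trans (le_add_of_nonneg_right J.cast_nonneg)

namespace IsStartTimes

variable {E : Set (ℝ × ℕ)} {t : ℕ → ℝ} {s s' : ℝ} {i j : ℕ}

theorem start_mem (ht : IsStartTimes E t) (h : (s, j) ∈ E) : (t j, j) ∈ E :=
  ht.mem_of_le h le_rfl (ht.start_le h)

theorem nonneg (ht : IsStartTimes E t) (h : (s, j) ∈ E) : 0 ≤ s :=
  (ht.zero ▸ ht.mono (Nat.zero_le j)).trans (ht.start_le h)

theorem start_mem_of_le (ht : IsStartTimes E t) (hij : i ≤ j) (h : (s, j) ∈ E) : (t i, i) ∈ E := by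
  induction j, hij using Nat.le_induction generalizing s with
  | base => exact ht.start_mem h
  | succ j _ ih => exact ih (ht.end_mem h)

theorem le_start_of_lt (ht : IsStartTimes E t) (hij : i < j) (h : (s, i) ∈ E)
    (h' : (s', j) ∈ E) : s ≤ t j :=
  (ht.le_end h (ht.start_mem_of_le (Nat.succ_le_of_lt hij) h')).trans (ht.mono hij)

variable {V : Type} {φ : HybridSignal V}

theorem Icc_subset_slice (ht : IsStartTimes φ.dom t) (h : (s, j) ∈ φ.dom) :
    Icc (t j) s ⊆ φ.slice j := fun _ hr => ht.mem_of_le h hr.1 hr.2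

theorem slice_eq_Icc (ht : IsStartTimes φ.dom t) (h : (s, j + 1) ∈ φ.dom) :
    φ.slice j = Icc (t j) (t (j + 1)) :=
  Subset.antisymm (fun _ hs => ⟨ht.start_le hs, ht.le_end hs h⟩)
    (ht.Icc_subset_slice (ht.end_mem h))

theorem interior_slice_subset (ht : IsStartTimes φ.dom t) (j : ℕ) :
    interior (φ.slice j) ⊆ Ioi (t j) := by
  rw [← interior_Ici]
  exact interior_mono fun s hs => ht.start_le hs

theorem interior_slice_ae_eq (ht : IsStartTimes φ.dom t) (j : ℕ) :
    interior (φ.slice j) =ᵐ[volume] φ.slice j := by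
  have hconn : (φ.slice j).OrdConnected :=
    ⟨fun _ ha _ hb _ hr => ht.mem_of_le hb ((ht.start_le ha).trans hr.1) hr.2⟩
  exact interior_ae_eq_of_null_frontier
    (Convex.addHaar_frontier volume (convex_iff_ordConnected.2 hconn))

theorem firstIdx_eq (ht : IsStartTimes φ.dom t) (hs : s ∈ interior (φ.slice j)) :
    φ.firstIdx s = j := by
  have hj : (s, j) ∈ φ.dom := (interior_subset hs : s ∈ φ.slice j)
  refine le_antisymm (Nat.sInf_le hj) (le_csInf ⟨j, hj⟩ fun i hi => ?_)
  by_contra! h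
  exact (ht.interior_slice_subset j hs).not_ge (ht.le_start_of_lt h hi hj)

theorem disjoint_interior_slice (ht : IsStartTimes φ.dom t) :
    Pairwise (Function.onFun Disjoint fun j => interior (φ.slice j)) := fun _ _ hij =>
  Set.disjoint_left.2 fun _ hi hj => hij ((ht.firstIdx_eq hi).symm.trans (ht.firstIdx_eq hj))

theorem lintegral_domT_firstIdx (ht : IsStartTimes φ.dom t) (f : ℕ → ℝ → ℝ≥0∞) :
    ∫⁻ r in φ.domT, f (φ.firstIdx r) r = ∑' j, ∫⁻ r in φ.slice j, f j r := by
  have hdom : φ.domT = ⋃ j, φ.slice j := by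
    ext
    simp [HybridSignal.domT, HybridSignal.slice]
  have hae : (⋃ j, φ.slice j) =ᵐ[volume] ⋃ j, interior (φ.slice j) :=
    Filter.EventuallyEq.countable_iUnion fun j => (ht.interior_slice_ae_eq j).symm
  rw [hdom, Measure.restrict_congr_set hae,
    lintegral_iUnion (fun _ => isOpen_interior.measurableSet) ht.disjoint_interior_slice]
  refine tsum_congr fun j => ?_
  rw [← Measure.restrict_congr_set (ht.interior_slice_ae_eq j)]
  exact setLIntegral_congr_fun isOpen_interior.measurableSet fun s hs => by
    simp only [ht.firstIdx_eq hs]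

theorem setLIntegral_slice_le (ht : IsStartTimes φ.dom t) {f : ℝ → ℝ≥0∞} {b : ℝ≥0∞}
    (h : ∀ s, (s, j) ∈ φ.dom → ∫⁻ r in Icc (t j) s, f r ≤ b) : ∫⁻ r in φ.slice j, f r ≤ b := by
  rw [← Measure.restrict_congr_set (ht.interior_slice_ae_eq j)]
  have hsub : interior (φ.slice j) ⊆ ⋃ q : {q : ℚ // (q : ℝ) ∈ φ.slice j}, Icc (t j) (q : ℝ) := by
    intro s hs
    obtain ⟨e, he, hball⟩ := Metric.isOpen_iff.1 isOpen_interior s hs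
    obtain ⟨q, hq, hq'⟩ := exists_rat_btwn (show s < s + e by linarith)
    have hqm : (q : ℝ) ∈ φ.slice j := by
      refine interior_subset (hball ?_)
      rw [Metric.mem_ball, Real.dist_eq, abs_of_nonneg] <;> linarith
    exact mem_iUnion.2 ⟨⟨q, hqm⟩, (ht.interior_slice_subset j hs).le, hq.le⟩
  refine (lintegral_mono_set hsub).trans ?_
  rw [setLIntegral_iUnion_of_directed]
  · exact iSup_le fun q => h _ q.2
  · intro p q
    rcases le_total p.1 q.1 with hpq | hpq
    · exact ⟨q, Icc_subset_Icc_right (by exact_mod_cast hpq), subset_rfl⟩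
    · exact ⟨p, subset_rfl, Icc_subset_Icc_right (by exact_mod_cast hpq)⟩

end IsStartTimes

section Vec

variable {ι κ μ ν : Type}

@[simp]
theorem stack_first (a : Vec ι) (b : Vec κ) : (Vec.stack a b).first = a := rfl

@[simp]
theorem stack_second (a : Vec ι) (b : Vec κ) : (Vec.stack a b).second = b := rfl

section Norm

variable [Fintype ι] [Fintype κ]

theorem norm_sq_eq_first_add_second (x : Vec (ι ⊕ κ)) :
    ‖x‖ ^ 2 = ‖x.first‖ ^ 2 + ‖x.second‖ ^ 2 := by
  simp [EuclideanSpace.real_norm_sq_eq, Vec.first, Vec.second]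

theorem norm_first_le (x : Vec (ι ⊕ κ)) : ‖x.first‖ ≤ ‖x‖ :=
  le_of_sq_le_sq (by nlinarith [norm_sq_eq_first_add_second x]) (norm_nonneg x)

theorem norm_second_le (x : Vec (ι ⊕ κ)) : ‖x.second‖ ≤ ‖x‖ :=
  le_of_sq_le_sq (by nlinarith [norm_sq_eq_first_add_second x]) (norm_nonneg x)

theorem norm_stack_le (a : Vec ι) (b : Vec κ) : ‖Vec.stack a b‖ ≤ ‖a‖ + ‖b‖ := by
  refine le_of_sq_le_sq ?_ (by positivity)
  rw [norm_sq_eq_first_add_second, stack_first, stack_second]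
  nlinarith [mul_nonneg (norm_nonneg a) (norm_nonneg b)]

theorem inner_stack (a a' : Vec ι) (b b' : Vec κ) :
    inner ℝ (Vec.stack a b) (Vec.stack a' b') = inner ℝ a a' + inner ℝ b b' := by
  simp [PiLp.inner_apply, Vec.stack]

/-- `Vec.first` as a continuous linear map. -/
noncomputable def firstL (ι κ : Type) [Fintype ι] [Fintype κ] : Vec (ι ⊕ κ) →L[ℝ] Vec ι :=
  LinearMap.toContinuousLinearMap
    { toFun := Vec.first
      map_add' := fun _ _ => rfl
      map_smul' := fun _ _ => rfl }

/-- `Vec.second` as a continuous linear map. -/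
noncomputable def secondL (ι κ : Type) [Fintype ι] [Fintype κ] : Vec (ι ⊕ κ) →L[ℝ] Vec κ :=
  LinearMap.toContinuousLinearMap
    { toFun := Vec.second
      map_add' := fun _ _ => rfl
      map_smul' := fun _ _ => rfl }

end Norm

section Matrix

variable [Fintype κ] [Fintype μ]

/-- `mulV` as a continuous linear map, whose operator norm bounds `mulV`. -/
noncomputable def mulVL [Fintype ι] (M : Matrix ι κ ℝ) : Vec κ →L[ℝ] Vec ι :=
  LinearMap.toContinuousLinearMap
    { toFun := mulV M
      map_add' := fun x y => PiLp.ext fun i => congrFun (Matrix.mulVec_add M x.ofLp y.ofLp) i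
      map_smul' := fun c x => PiLp.ext fun i => congrFun (Matrix.mulVec_smul M c x.ofLp) i }

theorem mulVL_apply [Fintype ι] (M : Matrix ι κ ℝ) (x : Vec κ) : mulVL M x = mulV M x := rfl

theorem norm_mulV_le [Fintype ι] (M : Matrix ι κ ℝ) (x : Vec κ) :
    ‖mulV M x‖ ≤ ‖mulVL M‖ * ‖x‖ := (mulVL M).le_opNorm x

theorem mulV_mul (M : Matrix ι κ ℝ) (N : Matrix κ μ ℝ) (x : Vec μ) :
    mulV (M * N) x = mulV M (mulV N x) := by
  simp [mulV, Matrix.mulVec_mulVec]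

theorem mulV_add_matrix (M N : Matrix ι κ ℝ) (x : Vec κ) :
    mulV (M + N) x = mulV M x + mulV N x := by
  ext i
  simp [mulV, Matrix.add_mulVec]

theorem mulV_smul_matrix (c : ℝ) (M : Matrix ι κ ℝ) (x : Vec κ) :
    mulV (c • M) x = c • mulV M x := by
  ext i
  simp [mulV, Matrix.smul_mulVec]

theorem mulV_one [DecidableEq κ] (x : Vec κ) : mulV (1 : Matrix κ κ ℝ) x = x := by
  simp [mulV]

theorem mulV_fromCols (M : Matrix ι κ ℝ) (N : Matrix ι μ ℝ) (x : Vec (κ ⊕ μ)) :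
    mulV (Matrix.fromCols M N) x = mulV M x.first + mulV N x.second :=
  PiLp.ext fun i => congrFun (Matrix.fromCols_mulVec M N x.ofLp) i

theorem mulV_fromRows (M : Matrix ι μ ℝ) (N : Matrix ν μ ℝ) (x : Vec μ) :
    mulV (Matrix.fromRows M N) x = Vec.stack (mulV M x) (mulV N x) :=
  PiLp.ext fun i => congrFun (Matrix.fromRows_mulVec M N x.ofLp) i

theorem mulV_fromBlocks (M₁₁ : Matrix ι κ ℝ) (M₁₂ : Matrix ι μ ℝ) (M₂₁ : Matrix ν κ ℝ)
    (M₂₂ : Matrix ν μ ℝ) (x : Vec (κ ⊕ μ)) :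
    mulV (Matrix.fromBlocks M₁₁ M₁₂ M₂₁ M₂₂) x =
      Vec.stack (mulV M₁₁ x.first + mulV M₁₂ x.second)
        (mulV M₂₁ x.first + mulV M₂₂ x.second) := by
  rw [← mulV_fromCols, ← mulV_fromCols, ← mulV_fromRows, Matrix.fromRows_fromCols_eq_fromBlocks]

variable [Fintype ι]

theorem inner_mulV_transpose (M : Matrix ι κ ℝ) (x : Vec κ) (y : Vec ι) :
    inner ℝ x (mulV Mᵀ y) = inner ℝ (mulV M x) y := by
  simp only [EuclideanSpace.inner_eq_star_dotProduct, mulV, star_trivial]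
  rw [Matrix.mulVec_transpose, Matrix.dotProduct_mulVec]

theorem inner_mulV_comm {M : Matrix κ κ ℝ} (hM : Mᵀ = M) (x y : Vec κ) :
    inner ℝ x (mulV M y) = inner ℝ (mulV M x) y := by
  rw [← inner_mulV_transpose, hM]

theorem inner_mulV_fromBlocks (M₁₁ : Matrix ι ι ℝ) (M₁₂ : Matrix ι κ ℝ) (M₂₂ : Matrix κ κ ℝ)
    (x : Vec (ι ⊕ κ)) :
    inner ℝ x (mulV (Matrix.fromBlocks M₁₁ M₁₂ M₁₂ᵀ M₂₂) x) =
      inner ℝ x.first (mulV M₁₁ x.first) + 2 * inner ℝ x.first (mulV M₁₂ x.second) +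
        inner ℝ x.second (mulV M₂₂ x.second) := by
  have hx : x = Vec.stack x.first x.second := PiLp.ext fun i => by cases i <;> rfl
  rw [mulV_fromBlocks]
  nth_rewrite 1 [hx]
  rw [inner_stack, inner_add_right, inner_add_right, inner_mulV_transpose, real_inner_comm x.first]
  ring

theorem inner_mulV_mulV_le [Fintype ν] (M : Matrix ι κ ℝ) (N : Matrix ι ν ℝ) (x : Vec κ)
    (y : Vec ν) : inner ℝ (mulV M x) (mulV N y) ≤ ‖mulVL M‖ * ‖mulVL N‖ * (‖x‖ * ‖y‖) :=
  calc inner ℝ (mulV M x) (mulV N y) ≤ ‖mulV M x‖ * ‖mulV N y‖ := real_inner_le_norm _ _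
    _ ≤ (‖mulVL M‖ * ‖x‖) * (‖mulVL N‖ * ‖y‖) := by gcongr <;> exact norm_mulV_le _ _
    _ = _ := by ring

theorem inner_mulV_self_le (M : Matrix κ κ ℝ) (x : Vec κ) :
    inner ℝ x (mulV M x) ≤ ‖mulVL M‖ * ‖x‖ ^ 2 := by
  refine (real_inner_le_norm _ _).trans ?_
  nlinarith [norm_mulV_le M x, norm_nonneg x]

open scoped MatrixOrder in
theorem exists_pos_mul_norm_sq_le_inner_mulV {M : Matrix κ κ ℝ} (hM : M.PosDef) :
    ∃ c > (0 : ℝ), ∀ x : Vec κ, c * ‖x‖ ^ 2 ≤ inner ℝ x (mulV M x) := by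
  classical
  cases isEmpty_or_nonempty κ
  · exact ⟨1, one_pos, fun x => by simp [Subsingleton.elim x 0]⟩
  obtain ⟨c, hc, hle⟩ := (CFC.exists_pos_algebraMap_le_iff hM.isHermitian).2 fun x hx =>
    hM.isStrictlyPositive.spectrum_pos hx
  refine ⟨c, hc, fun x => ?_⟩
  have h := (Matrix.le_iff.1 hle).dotProduct_mulVec_nonneg x.ofLp
  rw [Algebra.algebraMap_eq_smul_one, Matrix.sub_mulVec, Matrix.smul_mulVec, Matrix.one_mulVec,
    dotProduct_sub, dotProduct_smul, star_trivial, sub_nonneg, smul_eq_mul] at h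
  rw [← real_inner_self_eq_norm_sq, EuclideanSpace.inner_eq_star_dotProduct,
    EuclideanSpace.inner_eq_star_dotProduct, star_trivial, dotProduct_comm (mulV M x).ofLp]
  exact h

end Matrix

end Vec

section EssentialBounds

variable {ι : Type} [Fintype ι] {u : HybridSignal (Vec ι)} {s : ℝ} {j : ℕ}

theorem HybridSignal.norm_le_linfty_of_mem_jumpSet (hu : u.linfty < ⊤) (h : (s, j) ∈ u.jumpSet) :
    ‖u.val s j‖ ≤ u.linfty.toReal := by
  have hle : ‖u.val s j‖ₑ ≤ u.linfty :=
    le_iSup_of_le (f := u.linftyTrunc) (s + j) (le_max_of_le_right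
      (le_iSup₂ (f := fun (q : ℝ × ℕ)
        (_ : q ∈ {q : ℝ × ℕ | q ∈ u.jumpSet ∧ q.1 + q.2 ≤ s + j}) => ‖u.val q.1 q.2‖ₑ)
        (s, j) ⟨h, le_rfl⟩))
  simpa using ENNReal.toReal_mono hu.ne hle

theorem IsStartTimes.ae_norm_le_linfty {t : ℕ → ℝ} (ht : IsStartTimes u.dom t)
    (hu : u.linfty < ⊤) (j : ℕ) :
    ∀ᵐ s ∂(volume.restrict (u.slice j)), ‖u.val s j‖ ≤ u.linfty.toReal := by
  set A : ℕ → Set ℝ := fun n => {s | (s, j) ∈ u.dom \ u.jumpSet ∧ s + j ≤ (n : ℝ)}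
  have hbound (n : ℕ) : ∀ᵐ s ∂(volume.restrict (A n)), ‖u.val s j‖ ≤ u.linfty.toReal := by
    have hess : essSup (fun s => ‖u.val s j‖ₑ) (volume.restrict (A n)) ≤ u.linfty :=
      le_iSup_of_le (f := u.linftyTrunc) n (le_max_of_le_left
        (le_iSup (fun k : ℕ => essSup (fun s => ‖u.val s k‖ₑ)
          (volume.restrict {s | (s, k) ∈ u.dom \ u.jumpSet ∧ s + k ≤ (n : ℝ)})) j))
    filter_upwards [ENNReal.ae_le_essSup fun s => ‖u.val s j‖ₑ] with s hs
    simpa using ENNReal.toReal_mono hu.ne (hs.trans hess)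
  have hcover : u.slice j ⊆ (⋃ n, A n) ∪ {t (j + 1)} := by
    intro s hs
    by_cases hj : (s, j) ∈ u.jumpSet
    · exact Or.inr (le_antisymm (ht.le_end hs hj.2) (ht.start_le hj.2))
    · obtain ⟨n, hn⟩ := exists_nat_ge (s + j)
      exact Or.inl (mem_iUnion.2 ⟨n, ⟨hs, hj⟩, hn⟩)
  refine ae_restrict_of_ae_restrict_of_subset hcover ((ae_restrict_union_iff _ _ _).2 ⟨?_, ?_⟩)
  · exact (ae_restrict_iUnion_iff A _).2 hbound
  · simp [Measure.restrict_singleton]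

end EssentialBounds

theorem exists_forall_mem_Ioo_hasDerivAt_of_lipschitzWith {E : Type*} [NormedAddCommGroup E]
    [NormedSpace ℝ E] [CompleteSpace E] {F : E → E} {K : NNReal} (hF : LipschitzWith K F)
    (x₀ : E) (T : ℝ) {e : ℝ} (he : 0 < e) :
    ∃ b, T < b ∧ b ≤ T + e ∧ ∃ f : ℝ → E, f T = x₀ ∧ AbsolutelyContinuousOnInterval f T b ∧
      ∀ s ∈ Ioo T b, HasDerivAt f (F (f s)) s := by
  set B : NNReal := ‖F x₀‖₊ + K with hB
  set d := min e (1 / ((B : ℝ) + 1))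
  have hd0 : 0 < d := lt_min he (by positivity)
  have hdB : d * (B + 1) ≤ 1 := (le_div_iff₀ (by positivity)).1 (min_le_right _ _)
  have hPL : IsPicardLindelof (fun _ => F) (tmin := T) (tmax := T + d)
      ⟨T, le_rfl, by linarith⟩ x₀ 1 0 B K := by
    refine IsPicardLindelof.of_time_independent (fun x hx => ?_) hF.lipschitzOnWith ?_
    · have hball : dist x x₀ ≤ 1 := by simpa using hx
      have hdist := (hF.dist_le_mul x x₀).trans (mul_le_of_le_one_right K.2 hball)
      have htri := norm_le_norm_add_norm_sub' (F x) (F x₀)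
      rw [← dist_eq_norm] at htri
      simpa [hB] using htri.trans (add_le_add_right hdist _)
    · simp only [add_sub_cancel_left, sub_self, max_eq_left hd0.le, NNReal.coe_one,
        NNReal.coe_zero, sub_zero]
      linarith
  obtain ⟨f, hf0, hf⟩ := hPL.exists_eq_forall_mem_Icc_hasDerivWithinAt₀
  have hcont : ContinuousOn f (Icc T (T + d)) := HasDerivWithinAt.continuousOn hf
  obtain ⟨M, hM⟩ := isCompact_Icc.exists_bound_of_continuousOn
    (hF.continuous.comp_continuousOn hcont)
  refine ⟨T + d, by linarith, by linarith [min_le_left e (1 / ((B : ℝ) + 1))], f, hf0, ?_,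
    fun s hs => (hf s (Ioo_subset_Icc_self hs)).hasDerivAt (Icc_mem_nhds hs.1 hs.2)⟩
  have hlip : LipschitzOnWith M.toNNReal f (Icc T (T + d)) :=
    (convex_Icc T (T + d)).lipschitzOnWith_of_nnnorm_hasDerivWithin_le hf fun s hs =>
      NNReal.coe_le_coe.1 ((hM s hs).trans (Real.le_coe_toNNReal M))
  rw [← uIcc_of_le (by linarith : T ≤ T + d)] at hlip
  exact hlip.absolutelyContinuousOnInterval

namespace HybridSystem

variable {ι κ μ : Type} [Fintype ι] [Fintype κ] [Fintype μ]

/-- `x` is a trajectory of the flow of `S` on the interval `I` with input `v`: the conditions that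
`IsSolutionPair` imposes on a single slice of a solution pair. -/
structure IsFlowPair (S : HybridSystem ι κ μ) (I : Set ℝ) (x : ℝ → Vec ι)
    (v : ℝ → Vec (κ ⊕ μ)) : Prop where
  arc : ∀ a b, a ≤ b → Icc a b ⊆ I → AbsolutelyContinuousOnInterval x a b
  aemeasurable : AEMeasurable v (volume.restrict I)
  ae_bounded : ∀ R : ℝ, ∃ M : ℝ, ∀ᵐ t ∂(volume.restrict (I ∩ Iic R)), ‖v t‖ ≤ M
  flow_mem : ∀ t ∈ interior I, x t ∈ S.flowSet
  flow_deriv : ∀ᵐ t ∂(volume.restrict I), HasDerivAt x (S.flowMap (x t) (v t).first) t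

variable {S : HybridSystem ι κ μ} {φ : HybridSignal (Vec ι)} {u : HybridSignal (Vec (κ ⊕ μ))}
  {x y : ℝ → Vec ι} {v w : ℝ → Vec (κ ⊕ μ)} {I I' : Set ℝ} {a b c T : ℝ} {K : NNReal}

theorem IsSolutionPair.slice_eq (hS : S.IsSolutionPair φ u) (j : ℕ) : φ.slice j = u.slice j := by
  simp only [HybridSignal.slice, hS.dom_eq]

theorem IsSolutionPair.isFlowPair (hS : S.IsSolutionPair φ u) (j : ℕ) :
    S.IsFlowPair (φ.slice j) (fun s => φ.val s j) (fun s => u.val s j) where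
  arc := hS.arc j
  aemeasurable := hS.slice_eq j ▸ (hS.input j).1
  ae_bounded := hS.slice_eq j ▸ (hS.input j).2
  flow_mem := hS.flow_mem j
  flow_deriv := hS.flow_deriv j

namespace IsFlowPair

theorem mono (h : S.IsFlowPair I x v) (hI : I' ⊆ I) : S.IsFlowPair I' x v where
  arc a b hab hsub := h.arc a b hab (hsub.trans hI)
  aemeasurable := h.aemeasurable.mono_set hI
  ae_bounded R := (h.ae_bounded R).imp fun _ hM =>
    ae_restrict_of_ae_restrict_of_subset (inter_subset_inter_left _ hI) hM
  flow_mem t ht := h.flow_mem t (interior_mono hI ht)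
  flow_deriv := ae_restrict_of_ae_restrict_of_subset hI h.flow_deriv

theorem of_absolutelyContinuousOnInterval {M : ℝ} (hx : AbsolutelyContinuousOnInterval x a b)
    (hv : AEMeasurable v (volume.restrict (Icc a b)))
    (hM : ∀ᵐ t ∂(volume.restrict (Icc a b)), ‖v t‖ ≤ M) (hmem : ∀ t ∈ Ioo a b, x t ∈ S.flowSet)
    (hd : ∀ᵐ t ∂(volume.restrict (Icc a b)), HasDerivAt x (S.flowMap (x t) (v t).first) t) :
    S.IsFlowPair (Icc a b) x v where
  arc c d hcd hsub := by
    have hab := nonempty_Icc.1 ((nonempty_Icc.2 hcd).mono hsub)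
    exact hx.mono (by rwa [uIcc_of_le hcd, uIcc_of_le hab])
  aemeasurable := hv
  ae_bounded R := ⟨M, ae_restrict_of_ae_restrict_of_subset inter_subset_left hM⟩
  flow_mem t ht := hmem t (by rwa [interior_Icc] at ht)
  flow_deriv := hd

theorem exists_ae_norm_le (h : S.IsFlowPair I x v) (hI : BddAbove I) :
    ∃ M, ∀ᵐ t ∂(volume.restrict I), ‖v t‖ ≤ M := by
  obtain ⟨R, hR⟩ := hI
  simpa only [inter_eq_left.2 fun _ ht => mem_Iic.2 (hR ht)] using h.ae_bounded R

theorem congr (hab : a ≤ b) (h : S.IsFlowPair (Icc a b) x v) (hxy : EqOn x y (Icc a b))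
    (hvw : v =ᵐ[volume.restrict (Icc a b)] w) : S.IsFlowPair (Icc a b) y w := by
  obtain ⟨M, hM⟩ := h.exists_ae_norm_le bddAbove_Icc
  have hIoo := Measure.restrict_congr_set (μ := volume) (Ioo_ae_eq_Icc (a := a) (b := b))
  refine of_absolutelyContinuousOnInterval (M := M) ?_ ?_ ?_ (fun t ht => ?_) ?_
  · exact absolutelyContinuousOnInterval_congr (h.arc a b hab subset_rfl) (by rwa [uIcc_of_le hab])
  · exact h.aemeasurable.congr hvw
  · filter_upwards [hM, hvw] with t ht ht'
    rwa [← ht']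
  · rw [← hxy (Ioo_subset_Icc_self ht)]
    exact h.flow_mem t (by rwa [interior_Icc])
  · rw [← hIoo]
    filter_upwards [hIoo ▸ h.flow_deriv, hIoo ▸ hvw, ae_restrict_mem measurableSet_Ioo]
      with t ht hvt ht'
    rw [← hxy (Ioo_subset_Icc_self ht'), ← hvt]
    exact ht.congr_of_eventuallyEq (hxy.symm.eventuallyEq_of_mem (Icc_mem_nhds ht'.1 ht'.2))

theorem union (hab : a ≤ b) (hbc : b ≤ c) (h : S.IsFlowPair (Icc a b) x v)
    (h' : S.IsFlowPair (Icc b c) x v) (hmem : x b ∈ S.flowSet) :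
    S.IsFlowPair (Icc a c) x v := by
  obtain ⟨M, hM⟩ := h.exists_ae_norm_le bddAbove_Icc
  obtain ⟨M', hM'⟩ := h'.exists_ae_norm_le bddAbove_Icc
  refine of_absolutelyContinuousOnInterval (M := max M M')
    (absolutelyContinuousOnInterval_trans hab hbc (h.arc a b hab subset_rfl)
      (h'.arc b c hbc subset_rfl)) ?_ ?_ (fun t ht => ?_) ?_
  · rw [← Icc_union_Icc_eq_Icc hab hbc]
    exact aemeasurable_union_iff.2 ⟨h.aemeasurable, h'.aemeasurable⟩
  · rw [← Icc_union_Icc_eq_Icc hab hbc, ae_restrict_union_iff]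
    exact ⟨hM.mono fun _ => le_max_of_le_left, hM'.mono fun _ => le_max_of_le_right⟩
  · rcases lt_trichotomy t b with hlt | rfl | hlt
    · exact h.flow_mem t (by rw [interior_Icc]; exact ⟨ht.1, hlt⟩)
    · exact hmem
    · exact h'.flow_mem t (by rw [interior_Icc]; exact ⟨hlt, ht.2⟩)
  · rw [← Icc_union_Icc_eq_Icc hab hbc, ae_restrict_union_iff]
    exact ⟨h.flow_deriv, h'.flow_deriv⟩

theorem exists_concat (hab : a ≤ b) (hbc : b ≤ c) (h : S.IsFlowPair (Icc a b) x v)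
    (h' : S.IsFlowPair (Icc b c) y w) (hxy : y b = x b) (hmem : x b ∈ S.flowSet) :
    ∃ f g, EqOn x f (Icc a b) ∧ EqOn v g (Icc a b) ∧ S.IsFlowPair (Icc a c) f g := by
  set f : ℝ → Vec ι := fun t => if t ≤ b then x t else y t with hf
  set g : ℝ → Vec (κ ⊕ μ) := fun t => if t ≤ b then v t else w t
  have hxf : EqOn x f (Icc a b) := fun t ht => (if_pos ht.2).symm
  have hvg : EqOn v g (Icc a b) := fun t ht => (if_pos ht.2).symm
  have hyf : EqOn y f (Icc b c) := fun t ht => by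
    rcases ht.1.eq_or_lt with rfl | hlt
    · simp [hf, hxy]
    · exact (if_neg hlt.not_ge).symm
  have hwg : w =ᵐ[volume.restrict (Icc b c)] g := by
    rw [← Measure.restrict_congr_set Ioc_ae_eq_Icc]
    filter_upwards [ae_restrict_mem measurableSet_Ioc] with t ht
    exact (if_neg ht.1.not_ge).symm
  exact ⟨f, g, hxf, hvg, (h.congr hab hxf (hvg.aeEq_restrict measurableSet_Icc)).union hab hbc
    (h'.congr hbc hyf hwg) (hxf (right_mem_Icc.2 hab) ▸ hmem)⟩

theorem exists_ae_norm_flowMap_le (h : S.IsFlowPair I x v) (hI : BddAbove I)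
    (hLip : LipschitzWith K fun p : Vec ι × Vec κ => S.flowMap p.1 p.2) :
    ∃ A ≥ 0, ∀ᵐ t ∂(volume.restrict I), ‖S.flowMap (x t) (v t).first‖ ≤ A + K * ‖x t‖ := by
  obtain ⟨M, hM⟩ := h.exists_ae_norm_le hI
  refine ⟨‖S.flowMap 0 0‖ + K * |M|, by positivity, ?_⟩
  filter_upwards [hM] with t ht
  have hfirst : ‖(v t).first‖ ≤ |M| := (norm_first_le _).trans (ht.trans (le_abs_self M))
  have hdist := hLip.dist_le_mul (x t, (v t).first) (0, 0)
  rw [Prod.dist_eq, dist_zero_right, dist_zero_right, dist_eq_norm] at hdist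
  calc ‖S.flowMap (x t) (v t).first‖
      ≤ ‖S.flowMap 0 0‖ + ‖S.flowMap (x t) (v t).first - S.flowMap 0 0‖ :=
        norm_le_norm_add_norm_sub' _ _
    _ ≤ ‖S.flowMap 0 0‖ + K * (|M| + ‖x t‖) := by
        gcongr
        refine hdist.trans (mul_le_mul_of_nonneg_left (max_le ?_ ?_) K.2)
        · exact le_add_of_nonneg_left (abs_nonneg M)
        · exact hfirst.trans (le_add_of_nonneg_right (norm_nonneg _))
    _ = ‖S.flowMap 0 0‖ + K * |M| + K * ‖x t‖ := by ring

-- There is no finite-time escape: `1 + ‖x‖²` grows at most exponentially.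
theorem exists_norm_le_of_Ico (h : S.IsFlowPair (Ico a T) x v)
    (hLip : LipschitzWith K fun p : Vec ι × Vec κ => S.flowMap p.1 p.2) :
    ∃ R, ∀ t ∈ Ico a T, ‖x t‖ ≤ R := by
  obtain ⟨A, hA, hgrowth⟩ := h.exists_ae_norm_flowMap_le bddAbove_Ico hLip
  refine ⟨Real.exp ((A + 2 * K) * (T - a)) * (1 + ‖x a‖ ^ 2), fun s hs => ?_⟩
  have hsub : Icc a s ⊆ Ico a T := fun r hr => ⟨hr.1, hr.2.trans_lt hs.2⟩
  have hexp : 1 + ‖x s‖ ^ 2 ≤ Real.exp ((A + 2 * K) * (s - a)) * (1 + ‖x a‖ ^ 2) := by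
    refine le_exp_mul_of_ae_hasDerivAt_le (f := fun r => 1 + ‖x r‖ ^ 2)
      (f' := fun r => 2 * inner ℝ (x r) (S.flowMap (x r) (v r).first)) hs.1
      (absolutelyContinuousOnInterval_contDiff_comp (g := fun y : Vec ι => 1 + ‖y‖ ^ 2)
        (contDiff_const.add (contDiff_id.norm_sq ℝ)) (h.arc a s hs.1 hsub)) ?_
    filter_upwards [ae_restrict_of_ae_restrict_of_subset hsub h.flow_deriv,
      ae_restrict_of_ae_restrict_of_subset hsub hgrowth] with r hr hr'
    refine ⟨hr.norm_sq.const_add 1, ?_⟩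
    have hinner := (real_inner_le_norm (x r) (S.flowMap (x r) (v r).first)).trans
      (mul_le_mul_of_nonneg_left hr' (norm_nonneg _))
    nlinarith [mul_nonneg hA (sq_nonneg (‖x r‖ - 1)), K.2]
  calc ‖x s‖ ≤ 1 + ‖x s‖ ^ 2 := by nlinarith [sq_nonneg (‖x s‖ - 1)]
    _ ≤ Real.exp ((A + 2 * K) * (s - a)) * (1 + ‖x a‖ ^ 2) := hexp
    _ ≤ Real.exp ((A + 2 * K) * (T - a)) * (1 + ‖x a‖ ^ 2) := by
        gcongr
        exact hs.2.le

theorem exists_lipschitzOnWith_of_Ico (h : S.IsFlowPair (Ico a T) x v)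
    (hLip : LipschitzWith K fun p : Vec ι × Vec κ => S.flowMap p.1 p.2) :
    ∃ D : NNReal, LipschitzOnWith D x (Ico a T) := by
  obtain ⟨A, -, hgrowth⟩ := h.exists_ae_norm_flowMap_le bddAbove_Ico hLip
  obtain ⟨R, hR⟩ := h.exists_norm_le_of_Ico hLip
  have hle : ∀ r ∈ Ico a T, ∀ s ∈ Ico a T, r ≤ s → dist (x s) (x r) ≤ (A + K * R) * dist s r := by
    intro r hr s hs hrs
    have hsub : Icc r s ⊆ Ico a T := fun q hq => ⟨hr.1.trans hq.1, hq.2.trans_lt hs.2⟩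
    rw [dist_eq_norm, Real.dist_eq, abs_of_nonneg (sub_nonneg.2 hrs)]
    refine norm_sub_le_of_ae_norm_hasDerivAt_le hrs (h.arc r s hrs hsub)
      (f' := fun q => S.flowMap (x q) (v q).first) ?_
    filter_upwards [ae_restrict_of_ae_restrict_of_subset hsub h.flow_deriv,
      ae_restrict_of_ae_restrict_of_subset hsub hgrowth, ae_restrict_mem measurableSet_Icc]
      with q hq hq' hmem
    exact ⟨hq, hq'.trans (by gcongr; exact hR q (hsub hmem))⟩
  refine ⟨(A + K * R).toNNReal, LipschitzOnWith.of_dist_le' fun s hs r hr => ?_⟩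
  rcases le_total r s with hrs | hrs
  · exact hle r hr s hs hrs
  · rw [dist_comm, dist_comm s]
    exact hle s hs r hr hrs

theorem exists_extend_Icc (h : S.IsFlowPair (Ico a T) x v)
    (hLip : LipschitzWith K fun p : Vec ι × Vec κ => S.flowMap p.1 p.2) :
    ∃ f, EqOn x f (Ico a T) ∧ S.IsFlowPair (Icc a T) f v := by
  obtain ⟨D, hD⟩ := h.exists_lipschitzOnWith_of_Ico hLip
  obtain ⟨f, hf, hxf⟩ := hD.extend_finite_dimension
  obtain ⟨M, hM⟩ := h.exists_ae_norm_le bddAbove_Ico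
  have hIco := Measure.restrict_congr_set (μ := volume) (Ico_ae_eq_Icc (a := a) (b := T))
  have hIoo := Measure.restrict_congr_set (μ := volume) (Ioo_ae_eq_Icc (a := a) (b := T))
  refine ⟨f, hxf, of_absolutelyContinuousOnInterval (M := M)
    hf.lipschitzOnWith.absolutelyContinuousOnInterval (hIco ▸ h.aemeasurable) (hIco ▸ hM)
    (fun t ht => ?_) ?_⟩
  · rw [← hxf (Ioo_subset_Ico_self ht)]
    exact h.flow_mem t (by rwa [interior_Ico])
  · rw [← hIoo]
    filter_upwards [ae_restrict_of_ae_restrict_of_subset Ioo_subset_Ico_self h.flow_deriv,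
      ae_restrict_mem measurableSet_Ioo] with t ht ht'
    rw [← hxf (Ioo_subset_Ico_self ht')]
    exact ht.congr_of_eventuallyEq
      (hxf.symm.eventuallyEq_of_mem (Filter.mem_of_superset (Ioo_mem_nhds ht'.1 ht'.2)
        Ioo_subset_Ico_self))

end IsFlowPair
end HybridSystem

section Maximality

variable {ι κ μ : Type} [Fintype ι] [Fintype κ] [Fintype μ] {S : HybridSystem ι κ μ}
  {φ : HybridSignal (Vec ι)} {u : HybridSignal (Vec (κ ⊕ μ))} {t : ℕ → ℝ} {J : ℕ} {b : ℝ}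
  {K : NNReal}

theorem HybridSignal.slice_of_lt {V : Type} {φ : HybridSignal V} {last : Set ℝ} {j : ℕ}
    (hdom : φ.dom = cutDomain t J last) (hj : j < J) : φ.slice j = Icc (t j) (t (j + 1)) := by
  simp only [HybridSignal.slice, hdom, mem_cutDomain_of_lt hj, ofPred_mem_eq]

theorem HybridSignal.slice_last {V : Type} {φ : HybridSignal V} {last : Set ℝ}
    (hdom : φ.dom = cutDomain t J last) : φ.slice J = last := by
  simp only [HybridSignal.slice, hdom, mem_cutDomain_self, ofPred_mem_eq]

theorem HybridSignal.slice_of_gt {V : Type} {φ : HybridSignal V} {last : Set ℝ} {j : ℕ}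
    (hdom : φ.dom = cutDomain t J last) (hj : J < j) : φ.slice j = ∅ :=
  eq_empty_of_forall_notMem fun _ hs => hj.not_ge (le_of_mem_cutDomain (hdom.le hs))

/-- The hybrid signal that agrees with `φ` on the intervals with index `j < J` and ends with the
interval `[t J, b]`, on which it is `f`. It serves to extend solution pairs. -/
noncomputable def HybridSignal.endWith {V : Type} (φ : HybridSignal V) (f : ℝ → V) (h0 : t 0 = 0)
    (hm : Monotone t) (hb : t J ≤ b) : HybridSignal V where
  dom := cutDomain t J (Icc (t J) b)
  isDomain := isHybridTimeDomain_cutDomain h0 hm hb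
  val s j := if j = J then f s else φ.val s j

namespace HybridSystem

theorem IsFlowPair.empty (x : ℝ → Vec ι) (v : ℝ → Vec (κ ⊕ μ)) : S.IsFlowPair ∅ x v where
  arc _ _ hab hsub := absurd (hsub (left_mem_Icc.2 hab)) (notMem_empty _)
  aemeasurable := by simp
  ae_bounded R := by simp
  flow_mem t ht := by simp at ht
  flow_deriv := by simp

theorem IsFlowPair.singleton (x : ℝ → Vec ι) (v : ℝ → Vec (κ ⊕ μ)) (a : ℝ) :
    S.IsFlowPair (Icc a a) x v :=
  have hx : LipschitzOnWith 0 x (uIcc a a) := by simp [LipschitzOnWith]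
  .of_absolutelyContinuousOnInterval (M := 0) hx.absolutelyContinuousOnInterval
    (by simp) (by simp) (by simp) (by simp)

theorem IsSolutionPair.endWith (hS : S.IsSolutionPair φ u) {f : ℝ → Vec ι}
    {g : ℝ → Vec (κ ⊕ μ)} (h0 : t 0 = 0) (hm : Monotone t) (hb : t J ≤ b)
    (hslice : ∀ j < J, φ.slice j = Icc (t j) (t (j + 1)))
    (hfg : S.IsFlowPair (Icc (t J) b) f g)
    (hinit : J = 0 → f 0 ∈ closure S.flowSet ∪ S.jumpSet)
    (hjump : ∀ i, J = i + 1 → φ.val (t J) i ∈ S.jumpSet ∧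
      f (t J) ∈ S.jumpMap (φ.val (t J) i) (u.val (t J) i).second) :
    S.IsSolutionPair (φ.endWith f h0 hm hb) (u.endWith g h0 hm hb) := by
  have hflow (j : ℕ) : S.IsFlowPair ((φ.endWith f h0 hm hb).slice j)
      (fun s => if j = J then f s else φ.val s j) (fun s => if j = J then g s else u.val s j) := by
    rcases lt_trichotomy j J with hj | rfl | hj
    · have heq : (φ.endWith f h0 hm hb).slice j = φ.slice j :=
        (HybridSignal.slice_of_lt rfl hj).trans (hslice j hj).symm
      simpa only [heq, if_neg hj.ne] using hS.isFlowPair j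
    · have heq : (φ.endWith f h0 hm hb).slice j = Icc (t j) b := HybridSignal.slice_last rfl
      simpa only [heq, if_true] using hfg
    · have heq : (φ.endWith f h0 hm hb).slice j = ∅ := HybridSignal.slice_of_gt rfl hj
      exact heq ▸ .empty _ _
  refine ⟨fun j => (hflow j).arc, fun j => ⟨(hflow j).aemeasurable, (hflow j).ae_bounded⟩, rfl, ?_,
    fun j => (hflow j).flow_mem, fun j => (hflow j).flow_deriv, ?_⟩
  · change (if 0 = J then f 0 else φ.val 0 0) ∈ _
    split_ifs with hJ
    · exact hinit hJ.symm
    · exact hS.init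
  · rintro ⟨s, j⟩ ⟨hs₀, hs'⟩
    have hj : j + 1 ≤ J := le_of_mem_cutDomain hs'
    have hs : s ∈ Icc (t j) (t (j + 1)) := (mem_cutDomain_of_lt hj).1 hs₀
    change (if j = J then f s else φ.val s j) ∈ _ ∧ (if j + 1 = J then f s else φ.val s (j + 1)) ∈
      S.jumpMap (if j = J then f s else φ.val s j) (if j = J then g s else u.val s j).second
    simp only [if_neg (show j ≠ J by omega)]
    split_ifs with hJ
    · subst hJ
      obtain rfl : s = t (j + 1) := le_antisymm hs.2 (mem_cutDomain_self.1 hs').1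
      exact hjump j rfl
    · have hlt : j + 1 < J := by omega
      refine hS.jump (s, j) ⟨(hslice j (by omega)).ge hs, (hslice (j + 1) hlt).ge ?_⟩
      exact (mem_cutDomain_of_lt hlt).1 hs'

theorem IsMaximalPair.dom_eq_cutDomain (hφ : S.IsMaximalPair φ u) {f : ℝ → Vec ι}
    {g : ℝ → Vec (κ ⊕ μ)} (h0 : t 0 = 0) (hm : Monotone t) (hb : t J ≤ b)
    (hslice : ∀ j < J, φ.slice j = Icc (t j) (t (j + 1)))
    (hfg : S.IsFlowPair (Icc (t J) b) f g)
    (hinit : J = 0 → f 0 ∈ closure S.flowSet ∪ S.jumpSet)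
    (hjump : ∀ i, J = i + 1 → φ.val (t J) i ∈ S.jumpSet ∧
      f (t J) ∈ S.jumpMap (φ.val (t J) i) (u.val (t J) i).second)
    (hdom : φ.dom ⊆ cutDomain t J (Icc (t J) b))
    (hf : EqOn f (fun s => φ.val s J) (φ.slice J)) (hg : EqOn g (fun s => u.val s J) (φ.slice J)) :
    φ.dom = cutDomain t J (Icc (t J) b) := by
  refine (hφ.2 _ _ (hφ.1.endWith h0 hm hb hslice hfg hinit hjump) ⟨hdom, fun s j hs => ?_⟩
    ⟨hφ.1.dom_eq ▸ hdom, fun s j hs => ?_⟩).symm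
  · change (if j = J then f s else φ.val s j) = _
    split_ifs with hj
    · exact hj ▸ hf (hj ▸ hs)
    · rfl
  · change (if j = J then g s else u.val s j) = _
    split_ifs with hj
    · exact hj ▸ hg (hj ▸ hφ.1.dom_eq.ge hs)
    · rfl

theorem IsMaximalPair.last_eq_Icc (hφ : S.IsMaximalPair φ u) {last : Set ℝ} (h0 : t 0 = 0)
    (hm : Monotone t) (hdom : φ.dom = cutDomain t J last) (hmem : t J ∈ last)
    (hsub : last ⊆ Icc (t J) b) {f : ℝ → Vec ι} {g : ℝ → Vec (κ ⊕ μ)}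
    (hf : EqOn (fun s => φ.val s J) f last) (hg : EqOn (fun s => u.val s J) g last)
    (hfg : S.IsFlowPair (Icc (t J) b) f g) : last = Icc (t J) b := by
  have hlast : φ.slice J = last := HybridSignal.slice_last hdom
  have hslice (j : ℕ) (hj : j < J) := HybridSignal.slice_of_lt hdom hj
  have heq := hφ.dom_eq_cutDomain h0 hm (hsub hmem).2 hslice hfg (fun hJ => ?_) (fun i hi => ?_)
    ?_ (hlast ▸ hf.symm) (hlast ▸ hg.symm)
  · exact hlast.symm.trans (HybridSignal.slice_last heq)
  · subst hJ
    rw [← hf (h0 ▸ hmem)]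
    exact hφ.1.init
  · subst hi
    rw [← hf hmem]
    exact hφ.1.jump (t (i + 1), i) ⟨(hslice i (Nat.lt_succ_self i)).ge
      (right_mem_Icc.2 (hm (Nat.le_succ i))), hlast.ge hmem⟩
  · rintro ⟨s, j⟩ hs
    rw [hdom] at hs
    exact hs.imp_right fun h => ⟨h.1, hsub h.2⟩

theorem IsMaximalPair.jumpMap_eq_empty (hφ : S.IsMaximalPair φ u) (h0 : t 0 = 0)
    (hm : Monotone t) (hdom : φ.dom = cutDomain t J (Icc (t J) (t (J + 1))))
    (hx : φ.val (t (J + 1)) J ∈ S.jumpSet) :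
    S.jumpMap (φ.val (t (J + 1)) J) (u.val (t (J + 1)) J).second = ∅ := by
  refine eq_empty_of_forall_notMem fun y hy => ?_
  have hslice (j : ℕ) (hj : j < J + 1) : φ.slice j = Icc (t j) (t (j + 1)) := by
    rcases (Nat.lt_succ_iff.1 hj).lt_or_eq with hlt | rfl
    · exact HybridSignal.slice_of_lt hdom hlt
    · exact HybridSignal.slice_last hdom
  have hempty : φ.slice (J + 1) = ∅ := HybridSignal.slice_of_gt hdom (Nat.lt_succ_self J)
  have heq := hφ.dom_eq_cutDomain h0 hm le_rfl hslice
    (.singleton (fun _ => y) (fun _ => 0) (t (J + 1))) (by omega) ?_ ?_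
    (hempty ▸ eqOn_empty _ _) (hempty ▸ eqOn_empty _ _)
  · have hnew : t (J + 1) ∈ φ.slice (J + 1) :=
      heq.ge (mem_cutDomain_self.2 (left_mem_Icc.2 le_rfl))
    simp [hempty] at hnew
  · rintro i hi
    obtain rfl := Nat.succ_injective hi
    exact ⟨hx, hy⟩
  · rintro ⟨s, j⟩ hs
    have hj : j < J + 1 := Nat.lt_succ_iff.2 (le_of_mem_cutDomain (hdom ▸ hs : (s, j) ∈ _))
    exact (mem_cutDomain_of_lt hj).2 ((hslice j hj).le hs)

theorem IsMaximalPair.isComplete (hφ : S.IsMaximalPair φ u)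
    (hLip : LipschitzWith K fun p : Vec ι × Vec κ => S.flowMap p.1 p.2)
    (hprogress : ∀ T j, (T, j) ∈ φ.dom →
      (φ.val T j ∈ S.jumpSet ∧ ∀ η, (S.jumpMap (φ.val T j) η).Nonempty) ∨
      (φ.val T j ∈ S.flowSet ∧ ∃ b > T, ∃ y v, y T = φ.val T j ∧ S.IsFlowPair (Icc T b) y v)) :
    φ.IsComplete := by
  by_contra hc
  obtain ⟨t, J, last, h0, hm, hdom, hlast⟩ := φ.exists_dom_eq_cutDomain hc
  have hflow : S.IsFlowPair last (fun s => φ.val s J) (fun s => u.val s J) := by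
    simpa only [HybridSignal.slice_last hdom] using hφ.1.isFlowPair J
  rcases hlast with rfl | ⟨hlt, rfl⟩
  · have hle : t J ≤ t (J + 1) := hm (Nat.le_succ J)
    have hend := right_mem_Icc.2 hle
    rcases hprogress (t (J + 1)) J (hdom ▸ mem_cutDomain_self.2 hend) with
      ⟨hx, hne⟩ | ⟨hx, b, hb, y, v, hy, hyv⟩
    · exact (hne _).ne_empty (hφ.jumpMap_eq_empty h0 hm hdom hx)
    · obtain ⟨f, g, hf, hg, hfg⟩ := hflow.exists_concat hle hb.le hyv hy hx
      have heq := hφ.last_eq_Icc h0 hm hdom (left_mem_Icc.2 hle) (Icc_subset_Icc_right hb.le)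
        hf hg hfg
      exact hb.not_ge (heq.ge (right_mem_Icc.2 (hle.trans hb.le))).2
  · obtain ⟨f, hf, hfg⟩ := hflow.exists_extend_Icc hLip
    have heq := hφ.last_eq_Icc h0 hm hdom (left_mem_Ico.2 hlt) Ico_subset_Icc_self hf
      (eqOn_refl _ _) hfg
    exact lt_irrefl _ (heq.ge (right_mem_Icc.2 hlt.le)).2

end HybridSystem
end Maximality

section Storage

variable {ι κ μ ν : Type} [Fintype ι] [Fintype κ] [Fintype μ] [Fintype ν]

namespace HybridSystem

/-- Any two consecutive jumps of a solution pair of `S` are separated by at least `T`. -/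
def HasDwellTime (S : HybridSystem ι κ μ) (T : ℝ) : Prop :=
  ∀ φ u, S.IsSolutionPair φ u → ∀ s s' j, (s, j) ∈ φ.jumpSet → (s', j + 1) ∈ φ.jumpSet → s + T ≤ s'

/-- The solution pairs of `S` stay in the flow set, also at the end points of their intervals of
flow. -/
def StaysInFlowSet (S : HybridSystem ι κ μ) : Prop :=
  ∀ φ u, S.IsSolutionPair φ u → ∀ s j, (s, j) ∈ φ.dom → φ.val s j ∈ S.flowSet

/-- `V` is a quadratically bounded storage function of `S` for the set `A` and the output `h`: along
flows it decays at the rate `2 * lam` with supply `γ² ‖w‖² - ‖h x‖²`, and jumps increase it by at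
most `q ‖η‖²`. -/
structure IsStorage (S : HybridSystem ι κ μ) (A : Set (Vec ι)) (h : Vec ι → Vec ν) (V : Vec ι → ℝ)
    (lam γ q c₁ c₂ : ℝ) : Prop where
  contDiff : ContDiff ℝ 1 V
  lower : ∀ x ∈ S.flowSet, c₁ * Metric.infDist x A ^ 2 ≤ V x
  upper : ∀ x ∈ S.flowSet, V x ≤ c₂ * Metric.infDist x A ^ 2
  flow : ∀ x ∈ S.flowSet, ∀ w, fderiv ℝ V x (S.flowMap x w) ≤
    -(2 * lam) * V x - ‖h x‖ ^ 2 + γ ^ 2 * ‖w‖ ^ 2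
  jump : ∀ x ∈ S.jumpSet, ∀ η, ∀ y ∈ S.jumpMap x η, V y ≤ V x + q * ‖η‖ ^ 2

variable {S : HybridSystem ι κ μ} {A : Set (Vec ι)} {h : Vec ι → Vec ν} {V : Vec ι → ℝ}
  {lam γ q c₁ c₂ : ℝ} {φ : HybridSignal (Vec ι)} {u : HybridSignal (Vec (κ ⊕ μ))} {t : ℕ → ℝ}
  {x : ℝ → Vec ι} {v : ℝ → Vec (κ ⊕ μ)} {a b s T U : ℝ} {j : ℕ}

theorem IsSolutionPair.isFlowPair_Icc (hS : S.IsSolutionPair φ u) (ht : IsStartTimes φ.dom t)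
    (hs : (s, j) ∈ φ.dom) :
    S.IsFlowPair (Icc (t j) s) (fun r => φ.val r j) (fun r => u.val r j) :=
  (hS.isFlowPair j).mono (ht.Icc_subset_slice hs)

theorem IsSolutionPair.mem_jumpSet (hS : S.IsSolutionPair φ u) (ht : IsStartTimes φ.dom t)
    (hs : (s, j + 1) ∈ φ.dom) : (t (j + 1), j) ∈ φ.jumpSet ∧ (t (j + 1), j) ∈ u.jumpSet := by
  have hjump : (t (j + 1), j) ∈ φ.jumpSet := ⟨ht.end_mem hs, ht.start_mem hs⟩
  exact ⟨hjump, by simpa only [HybridSignal.jumpSet, hS.dom_eq] using hjump⟩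

theorem IsFlowPair.mapsTo_flowSet (hx : S.IsFlowPair (Icc a b) x v) (hab : a < b)
    (hclosed : IsClosed S.flowSet) : MapsTo x (Icc a b) S.flowSet := by
  have hcont : ContinuousOn x (closure (Ioo a b)) := by
    rw [closure_Ioo hab.ne, ← uIcc_of_le hab.le]
    exact (hx.arc a b hab.le subset_rfl).continuousOn
  have hmaps : MapsTo x (Ioo a b) S.flowSet := fun r hr =>
    hx.flow_mem r (by rwa [interior_Icc])
  simpa only [closure_Ioo hab.ne, hclosed.closure_eq] using hmaps.closure_of_continuousOn hcont

theorem StaysInFlowSet.of_isClosed (hclosed : IsClosed S.flowSet) (hsub : S.jumpSet ⊆ S.flowSet)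
    (hjump : ∀ x ∈ S.jumpSet, ∀ η, S.jumpMap x η ⊆ S.flowSet) : S.StaysInFlowSet := by
  intro φ u hS s j hs
  obtain ⟨t, ht⟩ := φ.isDomain.exists_isStartTimes
  have hstart : φ.val (t j) j ∈ S.flowSet := by
    rcases j with _ | j
    · rw [ht.zero]
      exact hS.init.elim (fun h => by rwa [hclosed.closure_eq] at h) (fun h => hsub h)
    · have hG := hS.jump _ (hS.mem_jumpSet ht hs).1
      exact hjump _ hG.1 _ hG.2
  rcases (ht.start_le hs).eq_or_lt with heq | hlt
  · rwa [← heq]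
  · exact (hS.isFlowPair_Icc ht hs).mapsTo_flowSet hlt hclosed (right_mem_Icc.2 hlt.le)

theorem HasDwellTime.add_le_start (hT : S.HasDwellTime T) (hS : S.IsSolutionPair φ u)
    (ht : IsStartTimes φ.dom t) (hs : (s, j + 2) ∈ φ.dom) : t (j + 1) + T ≤ t (j + 2) :=
  hT φ u hS _ _ j (hS.mem_jumpSet ht (ht.end_mem hs)).1 (hS.mem_jumpSet ht hs).1

theorem HasDwellTime.mul_le_add (hT : S.HasDwellTime T) (hT0 : 0 ≤ T) (hS : S.IsSolutionPair φ u)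
    (ht : IsStartTimes φ.dom t) (hs : (s, j) ∈ φ.dom) : T * j ≤ s + T := by
  have hstart (i : ℕ) (hi : (t (i + 1), i + 1) ∈ φ.dom) : T * i ≤ t (i + 1) := by
    induction i with
    | zero => simpa using ht.nonneg hi
    | succ i ih =>
      have hstep := hT.add_le_start hS ht hi
      have hprev := ih (ht.start_mem (ht.end_mem hi))
      push_cast
      linarith
  rcases j with _ | j
  · simpa using add_nonneg (ht.nonneg hs) hT0
  · have hle := (hstart j (ht.start_mem hs)).trans (ht.start_le hs)
    push_cast
    linarith

namespace IsStorage

theorem nonneg (hV : S.IsStorage A h V lam γ q c₁ c₂) (hc₁ : 0 ≤ c₁) {z : Vec ι}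
    (hz : z ∈ S.flowSet) : 0 ≤ V z :=
  (mul_nonneg hc₁ (sq_nonneg _)).trans (hV.lower z hz)

theorem ae_hasDerivAt (hV : S.IsStorage A h V lam γ q c₁ c₂) (hx : S.IsFlowPair (Icc a b) x v) :
    ∀ᵐ r ∂(volume.restrict (Icc a b)),
      HasDerivAt (fun r => V (x r)) (fderiv ℝ V (x r) (S.flowMap (x r) (v r).first)) r ∧
      fderiv ℝ V (x r) (S.flowMap (x r) (v r).first) ≤
        -(2 * lam) * V (x r) - ‖h (x r)‖ ^ 2 + γ ^ 2 * ‖(v r).first‖ ^ 2 := by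
  have hIoo := Measure.restrict_congr_set (μ := volume) (Ioo_ae_eq_Icc (a := a) (b := b))
  rw [← hIoo]
  filter_upwards [hIoo ▸ hx.flow_deriv, ae_restrict_mem measurableSet_Ioo] with r hr hr'
  exact ⟨((hV.contDiff.differentiable one_ne_zero).differentiableAt.hasFDerivAt).comp_hasDerivAt r
    hr, hV.flow _ (hx.flow_mem r (by rwa [interior_Icc])) _⟩

theorem sub_le_exp_mul_sub (hV : S.IsStorage A h V lam γ q c₁ c₂) (hlam : 0 < lam) (hab : a ≤ b)
    (hx : S.IsFlowPair (Icc a b) x v) (hU : ∀ᵐ r ∂(volume.restrict (Icc a b)), ‖v r‖ ≤ U) :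
    V (x b) - γ ^ 2 * U ^ 2 / (2 * lam) ≤
      Real.exp (-(2 * lam) * (b - a)) * (V (x a) - γ ^ 2 * U ^ 2 / (2 * lam)) := by
  set d := γ ^ 2 * U ^ 2 / (2 * lam)
  have hd : 2 * lam * d = γ ^ 2 * U ^ 2 := mul_div_cancel₀ _ (by positivity)
  have hac : AbsolutelyContinuousOnInterval (fun r => V (x r) - d) a b :=
    absolutelyContinuousOnInterval_contDiff_comp (g := fun z => V z - d)
      (hV.contDiff.sub contDiff_const) (hx.arc a b hab subset_rfl)
  refine le_exp_mul_of_ae_hasDerivAt_le hab hac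
    (f' := fun r => fderiv ℝ V (x r) (S.flowMap (x r) (v r).first)) ?_
  filter_upwards [hV.ae_hasDerivAt hx, hU] with r hr hrU
  refine ⟨hr.1.sub_const d, ?_⟩
  have hw : γ ^ 2 * ‖(v r).first‖ ^ 2 ≤ γ ^ 2 * U ^ 2 := by
    gcongr
    exact (norm_first_le _).trans hrU
  linarith [hr.2, sq_nonneg ‖h (x r)‖]

theorem le_of_start_le (hV : S.IsStorage A h V lam γ q c₁ c₂) (hlam : 0 < lam)
    (hS : S.IsSolutionPair φ u) (ht : IsStartTimes φ.dom t) (hs : (s, j) ∈ φ.dom)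
    (hU : ∀ᵐ r ∂(volume.restrict (φ.slice j)), ‖u.val r j‖ ≤ U) {V₀ e : ℝ}
    (hstart : V (φ.val (t j) j) ≤
      Real.exp (-(2 * lam) * t j) * V₀ + γ ^ 2 * U ^ 2 / (2 * lam) + e) :
    V (φ.val s j) ≤ Real.exp (-(2 * lam) * s) * V₀ + γ ^ 2 * U ^ 2 / (2 * lam) +
      Real.exp (-(2 * lam) * (s - t j)) * e := by
  set d := γ ^ 2 * U ^ 2 / (2 * lam)
  have hflow := hV.sub_le_exp_mul_sub hlam (ht.start_le hs) (hS.isFlowPair_Icc ht hs)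
    (ae_restrict_of_ae_restrict_of_subset (ht.Icc_subset_slice hs) hU)
  have hexp : Real.exp (-(2 * lam) * (s - t j)) * Real.exp (-(2 * lam) * t j) =
      Real.exp (-(2 * lam) * s) := by
    rw [← Real.exp_add, ← mul_add, sub_add_cancel]
  calc V (φ.val s j) ≤ Real.exp (-(2 * lam) * (s - t j)) * (V (φ.val (t j) j) - d) + d :=
        sub_le_iff_le_add.1 hflow
    _ ≤ Real.exp (-(2 * lam) * (s - t j)) * (Real.exp (-(2 * lam) * t j) * V₀ + e) + d := by
        gcongr
        linarith
    _ = _ := by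
        rw [mul_add, ← mul_assoc, hexp]
        ring

/-- A full interval of flow contracts by `exp (-2 * lam * T)` and a jump adds at most `q U²`, so an
excess `C U²` over the flow bound persists once `exp (-2 * lam * T) * C + q ≤ C`. -/
theorem start_le (hV : S.IsStorage A h V lam γ q c₁ c₂) (hlam : 0 < lam) (hq : 0 ≤ q)
    (hT : S.HasDwellTime T) (hS : S.IsSolutionPair φ u) (hu : u.linfty < ⊤)
    (ht : IsStartTimes φ.dom t) {C : ℝ} (hC : 0 ≤ C)
    (hCq : Real.exp (-(2 * lam) * T) * C + q ≤ C) (hj : (t (j + 1), j + 1) ∈ φ.dom) :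
    V (φ.val (t (j + 1)) (j + 1)) ≤ Real.exp (-(2 * lam) * t (j + 1)) * V (φ.val 0 0) +
      γ ^ 2 * u.linfty.toReal ^ 2 / (2 * lam) + C * u.linfty.toReal ^ 2 := by
  set U := u.linfty.toReal
  set d := γ ^ 2 * U ^ 2 / (2 * lam)
  have hU (i : ℕ) : ∀ᵐ r ∂(volume.restrict (φ.slice i)), ‖u.val r i‖ ≤ U := by
    rw [hS.slice_eq i]
    exact IsStartTimes.ae_norm_le_linfty (hS.dom_eq ▸ ht) hu i
  have hstep (i : ℕ) (hi : (t (i + 1), i + 1) ∈ φ.dom) :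
      V (φ.val (t (i + 1)) (i + 1)) ≤ V (φ.val (t (i + 1)) i) + q * U ^ 2 := by
    obtain ⟨hjump, hjump'⟩ := hS.mem_jumpSet ht hi
    refine (hV.jump _ (hS.jump _ hjump).1 _ _ (hS.jump _ hjump).2).trans ?_
    gcongr
    exact (norm_second_le _).trans (HybridSignal.norm_le_linfty_of_mem_jumpSet hu hjump')
  have hCqU : Real.exp (-(2 * lam) * T) * (C * U ^ 2) + q * U ^ 2 ≤ C * U ^ 2 := by
    rw [← mul_assoc, ← add_mul]
    gcongr
  induction j with
  | zero =>
    have hd : 0 ≤ d := by positivity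
    have hflow := hV.le_of_start_le (e := 0) (V₀ := V (φ.val 0 0)) hlam hS ht (ht.end_mem hj)
      (hU 0) (by simpa [ht.zero] using hd)
    have hpos : 0 ≤ Real.exp (-(2 * lam) * T) * (C * U ^ 2) := by positivity
    linarith [hstep 0 hj]
  | succ j ih =>
    have hend := ht.end_mem hj
    have hflow := hV.le_of_start_le hlam hS ht hend (hU (j + 1)) (ih (ht.start_mem hend))
    have hexp : Real.exp (-(2 * lam) * (t (j + 2) - t (j + 1))) * (C * U ^ 2) ≤
        Real.exp (-(2 * lam) * T) * (C * U ^ 2) := by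
      gcongr ?_ * _
      refine Real.exp_le_exp.2 (mul_le_mul_of_nonpos_left ?_ (by linarith))
      linarith [hT.add_le_start hS ht hj]
    linarith [hstep (j + 1) hj]

theorem exists_forall_le_exp_mul_add (hV : S.IsStorage A h V lam γ q c₁ c₂)
    (hlam : 0 < lam) (hq : 0 ≤ q) (hT0 : 0 < T) (hT : S.HasDwellTime T) :
    ∃ Γ ≥ 0, ∀ φ u, S.IsSolutionPair φ u → u.linfty < ⊤ → ∀ s j, (s, j) ∈ φ.dom →
      V (φ.val s j) ≤ Real.exp (-(2 * lam) * s) * V (φ.val 0 0) + Γ * u.linfty.toReal ^ 2 := by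
  have hexp : 0 < 1 - Real.exp (-(2 * lam) * T) :=
    sub_pos.2 (Real.exp_lt_one_iff.2 (by nlinarith))
  set C := q / (1 - Real.exp (-(2 * lam) * T))
  have hC : 0 ≤ C := div_nonneg hq hexp.le
  have hCq : Real.exp (-(2 * lam) * T) * C + q ≤ C := by
    linarith [div_mul_cancel₀ q hexp.ne']
  refine ⟨γ ^ 2 / (2 * lam) + C, by positivity, fun φ u hS hu s j hs => ?_⟩
  obtain ⟨t, ht⟩ := φ.isDomain.exists_isStartTimes
  set U := u.linfty.toReal
  have hstart : V (φ.val (t j) j) ≤ Real.exp (-(2 * lam) * t j) * V (φ.val 0 0) +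
      γ ^ 2 * U ^ 2 / (2 * lam) + C * U ^ 2 := by
    rcases j with _ | j
    · have hpos : 0 ≤ γ ^ 2 * U ^ 2 / (2 * lam) + C * U ^ 2 := by positivity
      simp only [ht.zero, mul_zero, Real.exp_zero, one_mul]
      linarith
    · exact hV.start_le hlam hq hT hS hu ht hC hCq (ht.start_mem hs)
  have hU : ∀ᵐ r ∂(volume.restrict (φ.slice j)), ‖u.val r j‖ ≤ U := by
    rw [hS.slice_eq j]
    exact IsStartTimes.ae_norm_le_linfty (hS.dom_eq ▸ ht) hu j
  have hdecay : Real.exp (-(2 * lam) * (s - t j)) ≤ 1 :=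
    Real.exp_le_one_iff.2 (by nlinarith [ht.start_le hs])
  calc V (φ.val s j) ≤ Real.exp (-(2 * lam) * s) * V (φ.val 0 0) + γ ^ 2 * U ^ 2 / (2 * lam) +
          Real.exp (-(2 * lam) * (s - t j)) * (C * U ^ 2) :=
        hV.le_of_start_le hlam hS ht hs hU hstart
    _ ≤ Real.exp (-(2 * lam) * s) * V (φ.val 0 0) + γ ^ 2 * U ^ 2 / (2 * lam) + C * U ^ 2 := by
        linarith [mul_le_of_le_one_left (by positivity : 0 ≤ C * U ^ 2) hdecay]
    _ = _ := by ring

end IsStorage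
end HybridSystem
end Storage

section InputToState

theorem exp_neg_mul_le_of_mul_le_add {lam T s n : ℝ} (hlam : 0 ≤ lam) (hT : 0 < T)
    (h : T * n ≤ s + T) : Real.exp (-lam * s) ≤
      Real.exp (lam * T / (1 + T)) * Real.exp (-(lam * T / (1 + T)) * (s + n)) := by
  have hle : (s + n - 1) * T ≤ s * (1 + T) := by linarith
  have hrate : lam * T / (1 + T) * (s + n - 1) ≤ lam * s := by
    rw [div_mul_eq_mul_div, div_le_iff₀ (by positivity)]
    linarith [mul_le_mul_of_nonneg_left hle hlam]
  rw [← Real.exp_add]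
  exact Real.exp_le_exp.2 (by linarith)

theorem le_max_of_two_mul_sq_le {e a b : ℝ} (ha : 0 ≤ a) (hb : 0 ≤ b)
    (h : 2 * e ^ 2 ≤ a ^ 2 + b ^ 2) : e ≤ max a b := by
  by_contra! hlt
  obtain ⟨hae, hbe⟩ := max_lt_iff.1 hlt
  linarith [pow_lt_pow_left₀ hae ha two_ne_zero, pow_lt_pow_left₀ hbe hb two_ne_zero]

namespace HybridSystem.IsStorage

variable {ι κ μ ν : Type} [Fintype ι] [Fintype κ] [Fintype μ] [Fintype ν]
  {S : HybridSystem ι κ μ} {A : Set (Vec ι)} {h : Vec ι → Vec ν} {V : Vec ι → ℝ}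
  {lam γ q c₁ c₂ T : ℝ}

theorem infDist_le_max (hV : S.IsStorage A h V lam γ q c₁ c₂) (hc₁ : 0 < c₁) (hc₂ : 0 ≤ c₂)
    {Γ s U : ℝ} (hΓ : 0 ≤ Γ) (hU : 0 ≤ U) {x x₀ : Vec ι} (hx : x ∈ S.flowSet) (hx₀ : x₀ ∈ S.flowSet)
    (h : V x ≤ Real.exp (-(2 * lam) * s) * V x₀ + Γ * U ^ 2) :
    Metric.infDist x A ≤
      max (√(2 * c₂ / c₁) * Real.exp (-lam * s) * Metric.infDist x₀ A) (√(2 * Γ / c₁) * U) := by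
  have hexp : Real.exp (-(2 * lam) * s) = Real.exp (-lam * s) ^ 2 := by
    rw [← Real.exp_nat_mul]
    congr 1
    push_cast
    ring
  have hle : c₁ * Metric.infDist x A ^ 2 ≤
      Real.exp (-lam * s) ^ 2 * (c₂ * Metric.infDist x₀ A ^ 2) + Γ * U ^ 2 := by
    rw [hexp] at h
    linarith [hV.lower x hx, mul_le_mul_of_nonneg_left (hV.upper x₀ hx₀)
      (sq_nonneg (Real.exp (-lam * s)))]
  refine le_max_of_two_mul_sq_le (mul_nonneg (by positivity) Metric.infDist_nonneg)
    (by positivity) ?_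
  simp only [mul_pow]
  rw [Real.sq_sqrt (by positivity), Real.sq_sqrt (by positivity), div_mul_eq_mul_div,
    div_mul_eq_mul_div, div_mul_eq_mul_div, ← add_div, le_div_iff₀ hc₁]
  linarith

theorem isPreEISS (hV : S.IsStorage A h V lam γ q c₁ c₂) (hlam : 0 < lam) (hq : 0 ≤ q)
    (hc₁ : 0 < c₁) (hc₂ : 0 < c₂) (hT0 : 0 < T) (hT : S.HasDwellTime T)
    (hflow : S.StaysInFlowSet) : S.IsPreEISS A := by
  obtain ⟨Γ, hΓ, hle⟩ := hV.exists_forall_le_exp_mul_add hlam hq hT0 hT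
  set rate := lam * T / (1 + T)
  refine ⟨√(2 * c₂ / c₁) * Real.exp rate, by positivity, rate, by positivity,
    fun r => (√(2 * Γ / c₁) + 1) * r, ⟨by fun_prop, fun x _ y _ hxy => ?_, mul_zero _⟩,
    fun φ u hS hu s j hs => ?_⟩
  · exact mul_lt_mul_of_pos_left hxy (by positivity)
  obtain ⟨t, ht⟩ := φ.isDomain.exists_isStartTimes
  have hU : 0 ≤ u.linfty.toReal := ENNReal.toReal_nonneg
  have hexp := exp_neg_mul_le_of_mul_le_add hlam.le hT0 (hT.mul_le_add hT0.le hS ht hs)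
  refine (hV.infDist_le_max hc₁ hc₂.le hΓ hU (hflow φ u hS s j hs) (hflow φ u hS 0 0 ht.zero_mem)
    (hle φ u hS hu s j hs)).trans (max_le_max ?_ ?_)
  · rw [mul_assoc √(2 * c₂ / c₁) (Real.exp rate)]
    exact mul_le_mul_of_nonneg_right (by gcongr) Metric.infDist_nonneg
  · linarith

end HybridSystem.IsStorage
end InputToState

section L2Gain

variable {ι κ μ ν : Type} [Fintype ι] [Fintype κ] [Fintype μ] [Fintype ν]

namespace HybridSystem

variable {S : HybridSystem ι κ μ} {A : Set (Vec ι)} {h : Vec ι → Vec ν} {V : Vec ι → ℝ}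
  {lam γ q c₁ c₂ a b : ℝ} {φ : HybridSignal (Vec ι)} {u : HybridSignal (Vec (κ ⊕ μ))}
  {t : ℕ → ℝ} {x : ℝ → Vec ι} {v : ℝ → Vec (κ ⊕ μ)}

theorem IsFlowPair.integrableOn_norm_first_sq (hx : S.IsFlowPair (Icc a b) x v) :
    IntegrableOn (fun r => ‖(v r).first‖ ^ 2) (Icc a b) := by
  obtain ⟨M, hM⟩ := hx.exists_ae_norm_le bddAbove_Icc
  have hmeas : AEMeasurable (fun r => (v r).first) (volume.restrict (Icc a b)) :=
    (firstL κ μ).continuous.measurable.comp_aemeasurable hx.aemeasurable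
  refine Integrable.of_bound (hmeas.norm.pow_const 2).aestronglyMeasurable (M ^ 2) ?_
  filter_upwards [hM] with r hr
  rw [norm_pow, norm_norm]
  gcongr
  exact (norm_first_le _).trans hr

theorem IsFlowPair.integrableOn_norm_sq (hx : S.IsFlowPair (Icc a b) x v) (hab : a ≤ b)
    (hh : Continuous h) : IntegrableOn (fun r => ‖h (x r)‖ ^ 2) (Icc a b) := by
  have hcont := (hx.arc a b hab subset_rfl).continuousOn
  rw [uIcc_of_le hab] at hcont
  exact ((hh.comp_continuousOn hcont).norm.pow 2).integrableOn_Icc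

namespace IsStorage

theorem add_integral_le (hV : S.IsStorage A h V lam γ q c₁ c₂) (hlam : 0 ≤ lam) (hc₁ : 0 ≤ c₁)
    (hh : Continuous h) (hab : a ≤ b) (hx : S.IsFlowPair (Icc a b) x v) :
    V (x b) + ∫ r in Icc a b, ‖h (x r)‖ ^ 2 ≤
      V (x a) + γ ^ 2 * ∫ r in Icc a b, ‖(v r).first‖ ^ 2 := by
  have hy := hx.integrableOn_norm_sq hab hh
  have hw := hx.integrableOn_norm_first_sq.const_mul (γ ^ 2)
  have hac : AbsolutelyContinuousOnInterval (fun r => V (x r)) a b :=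
    absolutelyContinuousOnInterval_contDiff_comp hV.contDiff (hx.arc a b hab subset_rfl)
  have hIoo := Measure.restrict_congr_set (μ := volume) (Ioo_ae_eq_Icc (a := a) (b := b))
  have hpos : ∀ᵐ r ∂(volume.restrict (Icc a b)), 0 ≤ V (x r) := by
    rw [← hIoo]
    filter_upwards [ae_restrict_mem measurableSet_Ioo] with r hr
    exact hV.nonneg hc₁ (hx.flow_mem r (by rwa [interior_Icc]))
  have hle := sub_le_integral_of_ae_hasDerivAt_le hab hac
    (f' := fun r => fderiv ℝ V (x r) (S.flowMap (x r) (v r).first))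
    (h := fun r => γ ^ 2 * ‖(v r).first‖ ^ 2 - ‖h (x r)‖ ^ 2) (by
      filter_upwards [hV.ae_hasDerivAt hx, hpos] with r hr hr0
      exact ⟨hr.1, by linarith [hr.2, mul_nonneg hlam hr0]⟩) (hw.sub' hy)
  rw [integral_sub hw hy, integral_const_mul] at hle
  linarith

theorem lintegral_add_le (hV : S.IsStorage A h V lam γ q c₁ c₂) (hlam : 0 ≤ lam) (hc₁ : 0 ≤ c₁)
    (hh : Continuous h) (hab : a ≤ b) (hx : S.IsFlowPair (Icc a b) x v)
    (ha : x a ∈ S.flowSet) (hb : x b ∈ S.flowSet) :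
    (∫⁻ r in Icc a b, ‖h (x r)‖ₑ ^ 2) + ENNReal.ofReal (V (x b)) ≤
      ENNReal.ofReal (V (x a)) +
        ENNReal.ofReal (γ ^ 2) * ∫⁻ r in Icc a b, ‖(v r).first‖ₑ ^ 2 := by
  have henorm {E : Type} [NormedAddCommGroup E] (y : E) :
      ‖y‖ₑ ^ 2 = ENNReal.ofReal (‖y‖ ^ 2) := by
    rw [ENNReal.ofReal_pow (norm_nonneg y), ofReal_norm]
  have hle := hV.add_integral_le hlam hc₁ hh hab hx
  simp only [henorm]
  rw [← ofReal_integral_eq_lintegral_ofReal (hx.integrableOn_norm_sq hab hh)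
      (ae_of_all _ fun _ => sq_nonneg _),
    ← ofReal_integral_eq_lintegral_ofReal hx.integrableOn_norm_first_sq
      (ae_of_all _ fun _ => sq_nonneg _),
    ← ENNReal.ofReal_mul (sq_nonneg γ),
    ← ENNReal.ofReal_add (integral_nonneg fun _ => sq_nonneg _) (hV.nonneg hc₁ hb),
    ← ENNReal.ofReal_add (hV.nonneg hc₁ ha)
      (mul_nonneg (sq_nonneg γ) (integral_nonneg fun _ => sq_nonneg _))]
  exact ENNReal.ofReal_le_ofReal (by linarith)

theorem lintegral_Icc_add_le (hV : S.IsStorage A h V lam γ q c₁ c₂) (hlam : 0 ≤ lam)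
    (hc₁ : 0 ≤ c₁) (hh : Continuous h) (hflow : S.StaysInFlowSet) (hS : S.IsSolutionPair φ u)
    (ht : IsStartTimes φ.dom t) {s : ℝ} {j : ℕ} (hs : (s, j) ∈ φ.dom) :
    (∫⁻ r in Icc (t j) s, ‖h (φ.val r j)‖ₑ ^ 2) + ENNReal.ofReal (V (φ.val s j)) ≤
      ENNReal.ofReal (V (φ.val (t j) j)) +
        ENNReal.ofReal (γ ^ 2) * ∫⁻ r in Icc (t j) s, ‖(u.val r j).first‖ₑ ^ 2 :=
  hV.lintegral_add_le hlam hc₁ hh (ht.start_le hs) (hS.isFlowPair_Icc ht hs)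
    (hflow φ u hS _ _ (ht.start_mem hs)) (hflow φ u hS _ _ hs)

theorem sum_lintegral_slice_add_le (hV : S.IsStorage A h V lam γ q c₁ c₂) (hlam : 0 ≤ lam)
    (hc₁ : 0 ≤ c₁) (hh : Continuous h) (hflow : S.StaysInFlowSet) (hS : S.IsSolutionPair φ u)
    (hη : ∀ s j, (s, j) ∈ u.dom → (u.val s j).second = 0) (ht : IsStartTimes φ.dom t) {n : ℕ}
    (hn : (t n, n) ∈ φ.dom) :
    (∑ j ∈ Finset.range n, ∫⁻ r in φ.slice j, ‖h (φ.val r j)‖ₑ ^ 2) +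
        ENNReal.ofReal (V (φ.val (t n) n)) ≤
      ENNReal.ofReal (V (φ.val 0 0)) + ENNReal.ofReal (γ ^ 2) *
        ∑ j ∈ Finset.range n, ∫⁻ r in φ.slice j, ‖(u.val r j).first‖ₑ ^ 2 := by
  induction n with
  | zero => simp [ht.zero]
  | succ n ih =>
    have hend := ht.end_mem hn
    obtain ⟨hjump, hjump'⟩ := hS.mem_jumpSet ht hn
    have hVjump : ENNReal.ofReal (V (φ.val (t (n + 1)) (n + 1))) ≤
        ENNReal.ofReal (V (φ.val (t (n + 1)) n)) := by
      have hle := hV.jump _ (hS.jump _ hjump).1 _ _ (hS.jump _ hjump).2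
      rw [hη _ _ hjump'.1, norm_zero] at hle
      exact ENNReal.ofReal_le_ofReal (by simpa using hle)
    have hVflow := hV.lintegral_Icc_add_le hlam hc₁ hh hflow hS ht hend
    rw [Finset.sum_range_succ, Finset.sum_range_succ, ht.slice_eq_Icc hn, mul_add, ← add_assoc,
      add_assoc]
    refine (add_le_add_right ((add_le_add_right hVjump _).trans hVflow) _).trans ?_
    rw [← add_assoc]
    exact add_le_add_left (ih (ht.start_mem hend)) _

theorem sum_lintegral_slice_le (hV : S.IsStorage A h V lam γ q c₁ c₂) (hlam : 0 ≤ lam)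
    (hc₁ : 0 ≤ c₁) (hh : Continuous h) (hflow : S.StaysInFlowSet) (hS : S.IsSolutionPair φ u)
    (hη : ∀ s j, (s, j) ∈ u.dom → (u.val s j).second = 0) (n : ℕ) :
    (∑ j ∈ Finset.range n, ∫⁻ r in φ.slice j, ‖h (φ.val r j)‖ₑ ^ 2) ≤
      ENNReal.ofReal (V (φ.val 0 0)) + ENNReal.ofReal (γ ^ 2) *
        ∑ j ∈ Finset.range n, ∫⁻ r in φ.slice j, ‖(u.val r j).first‖ₑ ^ 2 := by
  obtain ⟨t, ht⟩ := φ.isDomain.exists_isStartTimes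
  induction n with
  | zero => simp
  | succ n ih =>
    rw [Finset.sum_range_succ, Finset.sum_range_succ]
    by_cases hn : (t n, n) ∈ φ.dom
    · have hlast : ∫⁻ r in φ.slice n, ‖h (φ.val r n)‖ₑ ^ 2 ≤ ENNReal.ofReal (V (φ.val (t n) n)) +
          ENNReal.ofReal (γ ^ 2) * ∫⁻ r in φ.slice n, ‖(u.val r n).first‖ₑ ^ 2 := by
        refine ht.setLIntegral_slice_le fun s hs => le_self_add.trans
          ((hV.lintegral_Icc_add_le hlam hc₁ hh hflow hS ht hs).trans ?_)
        gcongr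
        exact ht.Icc_subset_slice hs
      refine (add_le_add_right hlast _).trans ?_
      rw [mul_add, ← add_assoc, ← add_assoc]
      exact add_le_add_left (hV.sum_lintegral_slice_add_le hlam hc₁ hh hflow hS hη ht hn) _
    · have hempty : φ.slice n = ∅ := eq_empty_of_forall_notMem fun s hs => hn (ht.start_mem hs)
      simpa [hempty] using ih

theorem lintegral_domT_le (hV : S.IsStorage A h V lam γ q c₁ c₂) (hlam : 0 ≤ lam)
    (hc₁ : 0 ≤ c₁) (hh : Continuous h) (hflow : S.StaysInFlowSet) (hS : S.IsSolutionPair φ u)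
    (hη : ∀ s j, (s, j) ∈ u.dom → (u.val s j).second = 0) :
    ∫⁻ s in φ.domT, ‖h (φ.val s (φ.firstIdx s))‖ₑ ^ 2 ≤ ENNReal.ofReal (V (φ.val 0 0)) +
      ENNReal.ofReal (γ ^ 2) * ∫⁻ s in u.domT, ‖(u.val s (u.firstIdx s)).first‖ₑ ^ 2 := by
  obtain ⟨t, ht⟩ := φ.isDomain.exists_isStartTimes
  have hw := IsStartTimes.lintegral_domT_firstIdx (φ := u) (hS.dom_eq ▸ ht)
    fun j s => ‖(u.val s j).first‖ₑ ^ 2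
  have hy := ht.lintegral_domT_firstIdx fun j s => ‖h (φ.val s j)‖ₑ ^ 2
  rw [hw, hy]
  refine ENNReal.tsum_le_of_sum_range_le fun n => ?_
  refine (hV.sum_lintegral_slice_le hlam hc₁ hh hflow hS hη n).trans ?_
  gcongr
  simp only [hS.slice_eq]
  exact ENNReal.sum_le_tsum _

theorem l2Norm_le (hV : S.IsStorage A h V lam γ q c₁ c₂) (hlam : 0 ≤ lam) (hc₁ : 0 ≤ c₁)
    (hc₂ : 0 ≤ c₂) (hγ : 0 ≤ γ) (hh : Continuous h) (hflow : S.StaysInFlowSet)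
    (hS : S.IsSolutionPair φ u) (hη : ∀ s j, (s, j) ∈ u.dom → (u.val s j).second = 0) :
    (∫⁻ s in φ.domT, ‖h (φ.val s (φ.firstIdx s))‖ₑ ^ 2) ^ (1 / 2 : ℝ) ≤
      ENNReal.ofReal (√c₂ * Metric.infDist (φ.val 0 0) A) + ENNReal.ofReal γ *
        (∫⁻ s in u.domT, ‖(u.val s (u.firstIdx s)).first‖ₑ ^ 2) ^ (1 / 2 : ℝ) := by
  obtain ⟨t, ht⟩ := φ.isDomain.exists_isStartTimes
  have hsqrt {r : ℝ} (hr : 0 ≤ r) : ENNReal.ofReal (r ^ 2) ^ (1 / 2 : ℝ) = ENNReal.ofReal r := by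
    rw [ENNReal.ofReal_rpow_of_nonneg (sq_nonneg r) one_half_pos.le, ← Real.sqrt_eq_rpow,
      Real.sqrt_sq hr]
  have hV₀ : V (φ.val 0 0) ≤ (√c₂ * Metric.infDist (φ.val 0 0) A) ^ 2 := by
    rw [mul_pow, Real.sq_sqrt hc₂]
    exact hV.upper _ (hflow φ u hS 0 0 ht.zero_mem)
  set W := ∫⁻ s in u.domT, ‖(u.val s (u.firstIdx s)).first‖ₑ ^ 2
  calc _ ≤ (ENNReal.ofReal ((√c₂ * Metric.infDist (φ.val 0 0) A) ^ 2) +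
          ENNReal.ofReal (γ ^ 2) * W) ^ (1 / 2 : ℝ) := by
        gcongr
        exact (hV.lintegral_domT_le hlam hc₁ hh hflow hS hη).trans (by gcongr)
    _ ≤ ENNReal.ofReal ((√c₂ * Metric.infDist (φ.val 0 0) A) ^ 2) ^ (1 / 2 : ℝ) +
          (ENNReal.ofReal (γ ^ 2) * W) ^ (1 / 2 : ℝ) :=
        ENNReal.rpow_add_le_add_rpow _ _ one_half_pos.le (by norm_num)
    _ = _ := by
        rw [ENNReal.mul_rpow_of_nonneg _ _ one_half_pos.le, hsqrt hγ,
          hsqrt (mul_nonneg (Real.sqrt_nonneg _) Metric.infDist_nonneg)]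

end IsStorage
end HybridSystem
end L2Gain

section State

variable {nz ny : ℕ}

/-- The estimation error `ε`. -/
def epsPart (x : Vec (StateIdx nz ny)) : Vec (Fin nz) := (errPart x).first

/-- The output estimation error `θ̃`. -/
def thetaPart (x : Vec (StateIdx nz ny)) : Vec (Fin ny) := (errPart x).second

/-- `epsPart` as a continuous linear map. -/
noncomputable def epsL (nz ny : ℕ) : Vec (StateIdx nz ny) →L[ℝ] Vec (Fin nz) :=
  (firstL _ _).comp ((firstL _ _).comp (secondL _ _))

/-- `thetaPart` as a continuous linear map. -/
noncomputable def thetaL (nz ny : ℕ) : Vec (StateIdx nz ny) →L[ℝ] Vec (Fin ny) :=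
  (secondL _ _).comp ((firstL _ _).comp (secondL _ _))

/-- `timer` as a continuous linear map. -/
noncomputable def timerL (nz ny : ℕ) : Vec (StateIdx nz ny) →L[ℝ] ℝ :=
  (EuclideanSpace.proj (0 : Fin 1)).comp ((secondL _ _).comp (secondL _ _))

theorem epsL_apply (x : Vec (StateIdx nz ny)) : epsL nz ny x = epsPart x := rfl

theorem thetaL_apply (x : Vec (StateIdx nz ny)) : thetaL nz ny x = thetaPart x := rfl

theorem timerL_apply (x : Vec (StateIdx nz ny)) : timerL nz ny x = timer x := rfl

theorem norm_errPart_sq (x : Vec (StateIdx nz ny)) :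
    ‖errPart x‖ ^ 2 = ‖epsPart x‖ ^ 2 + ‖thetaPart x‖ ^ 2 :=
  norm_sq_eq_first_add_second _

theorem norm_errPart_le (x : Vec (StateIdx nz ny)) : ‖errPart x‖ ≤ ‖x‖ :=
  (norm_first_le _).trans (norm_second_le x)

theorem mkState_sub_mkState (z z' : Vec (Fin nz)) (e e' : Vec (Fin nz ⊕ Fin ny)) (τ τ' : ℝ) :
    mkState z e τ - mkState z' e' τ' = mkState (z - z') (e - e') (τ - τ') :=
  PiLp.ext fun i => by rcases i with i | i | i <;> rfl

theorem mkState_eta (x : Vec (StateIdx nz ny)) : mkState (zPart x) (errPart x) (timer x) = x := by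
  ext i
  rcases i with i | i | i
  · rfl
  · rfl
  · obtain rfl : i = 0 := Subsingleton.elim _ _
    rfl

theorem norm_mkState_le (z : Vec (Fin nz)) (e : Vec (Fin nz ⊕ Fin ny)) (τ : ℝ) :
    ‖mkState z e τ‖ ≤ ‖z‖ + (‖e‖ + |τ|) := by
  have hτ : ‖(WithLp.toLp 2 fun _ => τ : Vec (Fin 1))‖ = |τ| := by
    simp [EuclideanSpace.norm_eq, Real.sqrt_sq_eq_abs]
  rw [← hτ]
  exact (norm_stack_le _ _).trans (add_le_add_right (norm_stack_le _ _) _)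

theorem lipschitzWith_mkState {α : Type*} [PseudoMetricSpace α] {z : α → Vec (Fin nz)}
    {e : α → Vec (Fin nz ⊕ Fin ny)} {K K' : NNReal} (hz : LipschitzWith K z)
    (he : LipschitzWith K' e) (τ : ℝ) : LipschitzWith (K + K') fun a => mkState (z a) (e a) τ := by
  refine LipschitzWith.of_dist_le_mul fun a b => ?_
  rw [dist_eq_norm, mkState_sub_mkState, sub_self]
  refine (norm_mkState_le _ _ _).trans ?_
  rw [abs_zero, add_zero, ← dist_eq_norm, ← dist_eq_norm, NNReal.coe_add, add_mul]
  exact add_le_add (hz.dist_le_mul a b) (he.dist_le_mul a b)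

theorem infDist_attractor {T₂ : ℝ} {x : Vec (StateIdx nz ny)} (hx : timer x ∈ Icc 0 T₂) :
    Metric.infDist x (Plant.attractor nz ny T₂) = ‖errPart x‖ := by
  have hmem : mkState (zPart x) 0 (timer x) ∈ Plant.attractor nz ny T₂ := ⟨rfl, hx⟩
  refine le_antisymm ((Metric.infDist_le_dist_of_mem hmem).trans ?_)
    ((Metric.le_infDist ⟨_, hmem⟩).2 fun y hy => ?_)
  · nth_rewrite 1 [← mkState_eta x]
    rw [dist_eq_norm, mkState_sub_mkState]
    simpa using norm_mkState_le (0 : Vec (Fin nz)) (errPart x) 0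
  · have hxy : errPart (x - y) = errPart x := (congrArg (errPart x - ·) hy.1).trans (sub_zero _)
    rw [dist_eq_norm, ← hxy]
    exact norm_errPart_le _

end State

namespace Plant

variable {nz ny nw nq ns np : ℕ} {P : Plant nz ny nw nq ns np}
  {L : Matrix (Fin nz) (Fin ny) ℝ} {H : Matrix (Fin ny) (Fin ny) ℝ} {T₁ T₂ : ℝ}

section ErrorSystem

theorem epsPart_flowMap (x : Vec (StateIdx nz ny)) (w : Vec (Fin nw)) :
    epsPart ((P.errorSystem L H T₁ T₂).flowMap x w) =
      mulV (P.A - L * P.C) (epsPart x) + mulV L (thetaPart x) +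
        mulV P.B (P.zeta (zPart x) (epsPart x)) + mulV P.N w := by
  change (mulV (P.calF L H) (errPart x)).first + (mulV P.calQ _).first + (mulV P.calT w).first = _
  rw [calF, calQ, calT, mulV_fromBlocks, mulV_fromRows, mulV_fromRows]
  rfl

theorem thetaPart_flowMap (x : Vec (StateIdx nz ny)) (w : Vec (Fin nw)) :
    thetaPart ((P.errorSystem L H T₁ T₂).flowMap x w) =
      mulV (P.C * P.A - P.C * L * P.C - H * P.C) (epsPart x) + mulV (P.C * L + H) (thetaPart x) +
        mulV (P.C * P.B) (P.zeta (zPart x) (epsPart x)) + mulV (P.C * P.N) w := by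
  change (mulV (P.calF L H) (errPart x)).second + (mulV P.calQ _).second +
    (mulV P.calT w).second = _
  rw [calF, calQ, calT, mulV_fromBlocks, mulV_fromRows, mulV_fromRows]
  rfl

theorem timer_flowMap (x : Vec (StateIdx nz ny)) (w : Vec (Fin nw)) :
    timer ((P.errorSystem L H T₁ T₂).flowMap x w) = -1 := rfl

theorem errPart_of_mem_jumpMap {x y : Vec (StateIdx nz ny)} {η : Vec (Fin ny)}
    (hy : y ∈ (P.errorSystem L H T₁ T₂).jumpMap x η) : errPart y = Vec.stack (epsPart x) (-η) := by
  obtain ⟨v, -, rfl⟩ := hy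
  change mulV (calG nz ny) (errPart x) + mulV (calN nz ny) η = _
  rw [calG, calN, mulV_fromBlocks, mulV_fromRows]
  ext i
  rcases i with i | i <;> simp [mulV, Vec.stack, epsPart, Matrix.neg_mulVec]

theorem timer_of_mem_jumpMap {x y : Vec (StateIdx nz ny)} {η : Vec (Fin ny)}
    (hy : y ∈ (P.errorSystem L H T₁ T₂).jumpMap x η) : timer y ∈ Icc T₁ T₂ := by
  obtain ⟨v, hv, rfl⟩ := hy
  exact hv

theorem exists_lipschitzWith_flowMap {K : NNReal} (hψ : LipschitzWith K P.ψ)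
    (L : Matrix (Fin nz) (Fin ny) ℝ) (H : Matrix (Fin ny) (Fin ny) ℝ) (T₁ T₂ : ℝ) :
    ∃ K', LipschitzWith K' fun p : Vec (StateIdx nz ny) × Vec (Fin nw) =>
      (P.errorSystem L H T₁ T₂).flowMap p.1 p.2 := by
  let state := ContinuousLinearMap.fst ℝ (Vec (StateIdx nz ny)) (Vec (Fin nw))
  let input := ContinuousLinearMap.snd ℝ (Vec (StateIdx nz ny)) (Vec (Fin nw))
  let zL := (firstL (Fin nz) ((Fin nz ⊕ Fin ny) ⊕ Fin 1)).comp state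
  let errL := (firstL (Fin nz ⊕ Fin ny) (Fin 1)).comp ((secondL _ _).comp state)
  let estL := zL - (epsL nz ny).comp state
  have hψS (f : Vec (StateIdx nz ny) × Vec (Fin nw) →L[ℝ] Vec (Fin nz)) :=
    hψ.comp ((mulVL P.S).comp f).lipschitz
  have hz := (((mulVL P.A).comp zL).lipschitz.add ((mulVL P.B).lipschitz.comp (hψS zL))).add
    ((mulVL P.N).comp input).lipschitz
  have he := (((mulVL (P.calF L H)).comp errL).lipschitz.add
    ((mulVL P.calQ).lipschitz.comp ((hψS zL).sub (hψS estL)))).add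
    ((mulVL P.calT).comp input).lipschitz
  exact ⟨_, lipschitzWith_mkState hz he (-1)⟩

end ErrorSystem

section MatrixInequality

variable {lamt ell δ χ τ : ℝ} {P₁ : Matrix (Fin nz) (Fin nz) ℝ} {P₂ : Matrix (Fin ny) (Fin ny) ℝ}

variable (P) in
/-- The part of the quadratic form of `calMred` that does not involve the timer. -/
noncomputable def formOne (lamt ell χ : ℝ) (P₁ : Matrix (Fin nz) (Fin nz) ℝ)
    (L : Matrix (Fin nz) (Fin ny) ℝ) (ε : Vec (Fin nz)) (θ : Vec (Fin ny)) (ζ : Vec (Fin ns)) : ℝ :=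
  2 * inner ℝ (mulV P₁ ε) (mulV (P.A - L * P.C) ε + mulV L θ + mulV P.B ζ) +
    2 * lamt * inner ℝ ε (mulV P₁ ε) + ‖mulV P.Cp ε‖ ^ 2 + χ * ell ^ 2 * ‖mulV P.S ε‖ ^ 2 -
    χ * ‖ζ‖ ^ 2

variable (P) in
/-- The factor of `e^{δτ}` in the quadratic form of `calMred`. -/
noncomputable def formTwo (lamt δ : ℝ) (P₂ : Matrix (Fin ny) (Fin ny) ℝ)
    (L : Matrix (Fin nz) (Fin ny) ℝ) (H : Matrix (Fin ny) (Fin ny) ℝ) (ε : Vec (Fin nz))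
    (θ : Vec (Fin ny)) (ζ : Vec (Fin ns)) : ℝ :=
  2 * inner ℝ (mulV P₂ θ) (mulV (P.C * P.A - P.C * L * P.C - H * P.C) ε +
      mulV (P.C * L + H) θ + mulV (P.C * P.B) ζ) +
    (2 * lamt - δ) * inner ℝ θ (mulV P₂ θ)

variable (P L H lamt ell δ χ τ P₁ P₂) in
theorem calMred_eq_fromBlocks :
    P.calMred lamt ell P₁ P₂ δ χ L H τ =
      let M₁₂ := Matrix.fromCols (P₁ * L + Real.exp (δ * τ) •
        ((P.C * P.A - P.C * L * P.C - H * P.C)ᵀ * P₂)) (P₁ * P.B)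
      let M₂₃ := Real.exp (δ * τ) • (P₂ * P.C * P.B)
      Matrix.fromBlocks
        (He (P₁ * (P.A - L * P.C)) + (2 * lamt) • P₁ + P.Cpᵀ * P.Cp +
          (χ * ell ^ 2) • (P.Sᵀ * P.S)) M₁₂ M₁₂ᵀ
        (Matrix.fromBlocks
          (Real.exp (δ * τ) • (He (P₂ * (P.C * L + H)) + (2 * lamt - δ) • P₂)) M₂₃ M₂₃ᵀ
          ((-χ) • (1 : Matrix (Fin ns) (Fin ns) ℝ))) := by
  ext i j
  rcases i with i | i | i <;> rcases j with j | j | j <;> rfl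

theorem inner_mulV_He {n : ℕ} (M : Matrix (Fin n) (Fin n) ℝ) (x : Vec (Fin n)) :
    inner ℝ x (mulV (He M) x) = 2 * inner ℝ x (mulV M x) := by
  rw [He, mulV_add_matrix, inner_add_right, inner_mulV_transpose, real_inner_comm x, two_mul]

theorem inner_mulV_calMred (hP₁ : P₁.IsSymm) (hP₂ : P₂.IsSymm)
    (x : Vec (Fin nz ⊕ (Fin ny ⊕ Fin ns))) :
    inner ℝ x (mulV (P.calMred lamt ell P₁ P₂ δ χ L H τ) x) =
      P.formOne lamt ell χ P₁ L x.first x.second.first x.second.second +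
        Real.exp (δ * τ) * P.formTwo lamt δ P₂ L H x.first x.second.first x.second.second := by
  rw [calMred_eq_fromBlocks, inner_mulV_fromBlocks, inner_mulV_fromBlocks, mulV_fromCols]
  set ε := x.first
  set θ := x.second.first
  simp only [mulV_add_matrix, mulV_smul_matrix, inner_add_right, inner_smul_right, inner_mulV_He,
    mulV_mul, inner_mulV_transpose, mulV_one, inner_mulV_comm hP₁ ε, inner_mulV_comm hP₂ θ,
    real_inner_self_eq_norm_sq, formOne, formTwo]
  rw [real_inner_comm (mulV P₂ θ) (mulV (P.C * P.A - P.C * L * P.C - H * P.C) ε)]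
  ring

theorem exists_formOne_add_formTwo_le_of_posDef (hP₁ : P₁.IsSymm) (hP₂ : P₂.IsSymm)
    (hM : (-P.calMred lamt ell P₁ P₂ δ χ L H τ).PosDef) :
    ∃ c > (0 : ℝ), ∀ ε θ ζ, P.formOne lamt ell χ P₁ L ε θ ζ +
      Real.exp (δ * τ) * P.formTwo lamt δ P₂ L H ε θ ζ ≤ -c * (‖ε‖ ^ 2 + ‖θ‖ ^ 2) := by
  obtain ⟨c, hc, hle⟩ := exists_pos_mul_norm_sq_le_inner_mulV hM
  refine ⟨c, hc, fun ε θ ζ => ?_⟩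
  have hx := hle (Vec.stack ε (Vec.stack θ ζ))
  rw [← neg_one_smul ℝ, mulV_smul_matrix, inner_smul_right, inner_mulV_calMred hP₁ hP₂,
    norm_sq_eq_first_add_second, norm_sq_eq_first_add_second (Vec.second _)] at hx
  simp only [stack_first, stack_second] at hx
  linarith [mul_nonneg hc.le (sq_nonneg ‖ζ‖)]

theorem exists_formOne_add_formTwo_le (hP₁ : P₁.IsSymm) (hP₂ : P₂.IsSymm) (hδ : 0 ≤ δ)
    (hM₀ : (-P.calMred lamt ell P₁ P₂ δ χ L H 0).PosDef)
    (hMT : (-P.calMred lamt ell P₁ P₂ δ χ L H T₂).PosDef) :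
    ∃ m > (0 : ℝ), ∀ τ ∈ Icc 0 T₂, ∀ ε θ ζ,
      P.formOne lamt ell χ P₁ L ε θ ζ + Real.exp (δ * τ) * P.formTwo lamt δ P₂ L H ε θ ζ ≤
        -m * (‖ε‖ ^ 2 + ‖θ‖ ^ 2) := by
  obtain ⟨c₀, hc₀, h₀⟩ := exists_formOne_add_formTwo_le_of_posDef hP₁ hP₂ hM₀
  obtain ⟨c₁, hc₁, h₁⟩ := exists_formOne_add_formTwo_le_of_posDef hP₁ hP₂ hMT
  refine ⟨min c₀ c₁, lt_min hc₀ hc₁, fun τ hτ ε θ ζ => ?_⟩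
  have hexp₀ : Real.exp (δ * 0) ≤ Real.exp (δ * τ) := by
    gcongr
    exact hτ.1
  have hexp₁ : Real.exp (δ * τ) ≤ Real.exp (δ * T₂) := by
    gcongr
    exact hτ.2
  have hm {c : ℝ} (hc : min c₀ c₁ ≤ c) :
      -c * (‖ε‖ ^ 2 + ‖θ‖ ^ 2) ≤ -min c₀ c₁ * (‖ε‖ ^ 2 + ‖θ‖ ^ 2) := by
    gcongr
  rcases le_total 0 (P.formTwo lamt δ P₂ L H ε θ ζ) with hb | hb
  · linarith [h₁ ε θ ζ, hm (min_le_right _ _), mul_le_mul_of_nonneg_right hexp₁ hb]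
  · linarith [h₀ ε θ ζ, hm (min_le_left _ _), mul_le_mul_of_nonpos_right hexp₀ hb]

end MatrixInequality

section Storage

variable {lamt ell δ χ : ℝ} {P₁ : Matrix (Fin nz) (Fin nz) ℝ} {P₂ : Matrix (Fin ny) (Fin ny) ℝ}

/-- The storage function `εᵀ P₁ ε + e^{δτ} θ̃ᵀ P₂ θ̃`. -/
noncomputable def storage (P₁ : Matrix (Fin nz) (Fin nz) ℝ) (P₂ : Matrix (Fin ny) (Fin ny) ℝ)
    (δ : ℝ) (x : Vec (StateIdx nz ny)) : ℝ :=
  inner ℝ (epsPart x) (mulV P₁ (epsPart x)) +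
    Real.exp (δ * timer x) * inner ℝ (thetaPart x) (mulV P₂ (thetaPart x))

theorem contDiff_storage : ContDiff ℝ 1 (storage P₁ P₂ δ) := by
  have hε := (epsL nz ny).contDiff (n := 1)
  have hθ := (thetaL nz ny).contDiff (n := 1)
  have hτ := (timerL nz ny).contDiff (n := 1)
  exact (hε.inner ℝ ((mulVL P₁).contDiff.comp hε)).add
    ((Real.contDiff_exp.comp (contDiff_const.mul hτ)).mul
      (hθ.inner ℝ ((mulVL P₂).contDiff.comp hθ)))

theorem fderiv_storage_apply (hP₁ : P₁.IsSymm) (hP₂ : P₂.IsSymm) (x v : Vec (StateIdx nz ny)) :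
    fderiv ℝ (storage P₁ P₂ δ) x v =
      2 * inner ℝ (mulV P₁ (epsPart x)) (epsPart v) +
        Real.exp (δ * timer x) * (2 * inner ℝ (mulV P₂ (thetaPart x)) (thetaPart v) +
          δ * timer v * inner ℝ (thetaPart x) (mulV P₂ (thetaPart x))) := by
  have hε := (epsL nz ny).hasFDerivAt (x := x)
  have hθ := (thetaL nz ny).hasFDerivAt (x := x)
  have hτ := (timerL nz ny).hasFDerivAt (x := x)
  have hV : HasFDerivAt (storage P₁ P₂ δ) _ x :=
    (hε.inner ℝ ((mulVL P₁).hasFDerivAt.comp x hε)).add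
      ((hτ.const_mul δ).exp.mul (hθ.inner ℝ ((mulVL P₂).hasFDerivAt.comp x hθ)))
  have hε_comm : inner ℝ (mulV P₁ (epsPart v)) (epsPart x) =
      inner ℝ (mulV P₁ (epsPart x)) (epsPart v) := by
    rw [← inner_mulV_comm hP₁, real_inner_comm]
  have hθ_comm : inner ℝ (mulV P₂ (thetaPart v)) (thetaPart x) =
      inner ℝ (mulV P₂ (thetaPart x)) (thetaPart v) := by
    rw [← inner_mulV_comm hP₂, real_inner_comm]
  rw [hV.fderiv]
  simp only [epsL_apply, Function.comp_apply, mulVL_apply, timerL_apply, thetaL_apply,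
    inner_mulV_comm hP₁, inner_mulV_comm hP₂, hε_comm, hθ_comm, add_apply, smul_apply,
    ContinuousLinearMap.comp_apply, ContinuousLinearMap.prod_apply, fderivInnerCLM_apply,
    smul_eq_mul]
  ring

theorem fderiv_storage_flowMap (hP₁ : P₁.IsSymm) (hP₂ : P₂.IsSymm) (x : Vec (StateIdx nz ny))
    (w : Vec (Fin nw)) :
    fderiv ℝ (storage P₁ P₂ δ) x ((P.errorSystem L H T₁ T₂).flowMap x w) =
      P.formOne lamt ell χ P₁ L (epsPart x) (thetaPart x) (P.zeta (zPart x) (epsPart x)) +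
        Real.exp (δ * timer x) * P.formTwo lamt δ P₂ L H (epsPart x) (thetaPart x)
          (P.zeta (zPart x) (epsPart x)) -
        2 * lamt * storage P₁ P₂ δ x - ‖P.perfOutput x‖ ^ 2 +
        χ * (‖P.zeta (zPart x) (epsPart x)‖ ^ 2 - (ell * ‖mulV P.S (epsPart x)‖) ^ 2) +
        2 * (inner ℝ (mulV P₁ (epsPart x)) (mulV P.N w) +
          Real.exp (δ * timer x) * inner ℝ (mulV P₂ (thetaPart x)) (mulV (P.C * P.N) w)) := by
  have hout : P.perfOutput x = mulV P.Cp (epsPart x) := rfl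
  rw [fderiv_storage_apply hP₁ hP₂, epsPart_flowMap, thetaPart_flowMap, timer_flowMap, storage,
    hout, formOne, formTwo, inner_add_right _ _ (mulV P.N w),
    inner_add_right _ _ (mulV (P.C * P.N) w)]
  ring

theorem norm_zeta_le (hψ : ∀ v₁ v₂, ‖P.ψ v₁ - P.ψ v₂‖ ≤ ell * ‖v₁ - v₂‖) (v₁ v₂ : Vec (Fin nz)) :
    ‖P.zeta v₁ v₂‖ ≤ ell * ‖mulV P.S v₂‖ := by
  refine (hψ _ _).trans_eq ?_
  rw [← mulVL_apply, ← mulVL_apply, ← mulVL_apply, ← map_sub, sub_sub_cancel]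

theorem exists_fderiv_storage_flowMap_le
    (hψ : ∀ v₁ v₂, ‖P.ψ v₁ - P.ψ v₂‖ ≤ ell * ‖v₁ - v₂‖)
    (hP₁ : P₁.IsSymm) (hP₂ : P₂.IsSymm) (hδ : 0 ≤ δ) (hχ : 0 ≤ χ)
    (hM₀ : (-P.calMred lamt ell P₁ P₂ δ χ L H 0).PosDef)
    (hMT : (-P.calMred lamt ell P₁ P₂ δ χ L H T₂).PosDef) :
    ∃ γ > (0 : ℝ), ∀ x, timer x ∈ Icc 0 T₂ → ∀ w,
      fderiv ℝ (storage P₁ P₂ δ) x ((P.errorSystem L H T₁ T₂).flowMap x w) ≤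
        -(2 * lamt) * storage P₁ P₂ δ x - ‖P.perfOutput x‖ ^ 2 + γ ^ 2 * ‖w‖ ^ 2 := by
  obtain ⟨m, hm, hform⟩ := exists_formOne_add_formTwo_le hP₁ hP₂ hδ hM₀ hMT
  set k₁ := ‖mulVL P₁‖ * ‖mulVL P.N‖
  set k₂ := Real.exp (δ * T₂) * (‖mulVL P₂‖ * ‖mulVL (P.C * P.N)‖)
  refine ⟨√((k₁ ^ 2 + k₂ ^ 2) / m + 1), by positivity, fun x hx w => ?_⟩
  have hζ : χ * (‖P.zeta (zPart x) (epsPart x)‖ ^ 2 - (ell * ‖mulV P.S (epsPart x)‖) ^ 2) ≤ 0 := by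
    refine mul_nonpos_of_nonneg_of_nonpos hχ (sub_nonpos.2 ?_)
    gcongr
    exact norm_zeta_le hψ _ _
  have hε : inner ℝ (mulV P₁ (epsPart x)) (mulV P.N w) ≤ k₁ * (‖epsPart x‖ * ‖w‖) :=
    inner_mulV_mulV_le _ _ _ _
  have hθ : Real.exp (δ * timer x) * inner ℝ (mulV P₂ (thetaPart x)) (mulV (P.C * P.N) w) ≤
      k₂ * (‖thetaPart x‖ * ‖w‖) := by
    rw [mul_assoc (Real.exp _)]
    refine (mul_le_mul_of_nonneg_left (inner_mulV_mulV_le _ _ _ _) (Real.exp_nonneg _)).trans ?_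
    gcongr
    exact hx.2
  rw [fderiv_storage_flowMap (lamt := lamt) (ell := ell) (χ := χ) hP₁ hP₂,
    Real.sq_sqrt (by positivity), add_mul, add_div, add_mul]
  linarith [hform _ hx (epsPart x) (thetaPart x) (P.zeta (zPart x) (epsPart x)),
    two_mul_mul_mul_le hm k₁ ‖epsPart x‖ ‖w‖, two_mul_mul_mul_le hm k₂ ‖thetaPart x‖ ‖w‖,
    sq_nonneg ‖w‖]

theorem exists_mul_norm_errPart_sq_le_storage (hP₁ : P₁.PosDef) (hP₂ : P₂.PosDef) (hδ : 0 ≤ δ) :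
    ∃ c > (0 : ℝ), ∀ x, 0 ≤ timer x → c * ‖errPart x‖ ^ 2 ≤ storage P₁ P₂ δ x := by
  obtain ⟨a, ha, hle₁⟩ := exists_pos_mul_norm_sq_le_inner_mulV hP₁
  obtain ⟨b, hb, hle₂⟩ := exists_pos_mul_norm_sq_le_inner_mulV hP₂
  refine ⟨min a b, lt_min ha hb, fun x hx => ?_⟩
  have hexp : 1 ≤ Real.exp (δ * timer x) := Real.one_le_exp (mul_nonneg hδ hx)
  rw [norm_errPart_sq, mul_add, storage]
  refine add_le_add ?_ ?_
  · exact (mul_le_mul_of_nonneg_right (min_le_left _ _) (sq_nonneg _)).trans (hle₁ _)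
  · have hθ : min a b * ‖thetaPart x‖ ^ 2 ≤ inner ℝ (thetaPart x) (mulV P₂ (thetaPart x)) :=
      (mul_le_mul_of_nonneg_right (min_le_right _ _) (sq_nonneg _)).trans (hle₂ _)
    exact hθ.trans (le_mul_of_one_le_left (le_trans (by positivity) hθ) hexp)

theorem exists_storage_le_mul_norm_errPart_sq (P₁ : Matrix (Fin nz) (Fin nz) ℝ)
    (P₂ : Matrix (Fin ny) (Fin ny) ℝ) (hδ : 0 ≤ δ) (T₂ : ℝ) :
    ∃ c > (0 : ℝ), ∀ x, timer x ≤ T₂ → storage P₁ P₂ δ x ≤ c * ‖errPart x‖ ^ 2 := by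
  set k₁ := ‖mulVL P₁‖
  set k₂ := Real.exp (δ * T₂) * ‖mulVL P₂‖
  refine ⟨k₁ + k₂ + 1, by positivity, fun x hx => ?_⟩
  have hε : inner ℝ (epsPart x) (mulV P₁ (epsPart x)) ≤ k₁ * ‖epsPart x‖ ^ 2 :=
    inner_mulV_self_le _ _
  have hθ : Real.exp (δ * timer x) * inner ℝ (thetaPart x) (mulV P₂ (thetaPart x)) ≤
      k₂ * ‖thetaPart x‖ ^ 2 := by
    rw [mul_assoc]
    refine (mul_le_mul_of_nonneg_left (inner_mulV_self_le _ _) (Real.exp_nonneg _)).trans ?_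
    gcongr
  rw [norm_errPart_sq, storage]
  have hpos : 0 ≤ (k₂ + 1) * ‖epsPart x‖ ^ 2 + (k₁ + 1) * ‖thetaPart x‖ ^ 2 := by positivity
  linarith

theorem storage_le_of_mem_jumpMap (hP₂ : P₂.PosDef) (hδ : 0 ≤ δ) {x y : Vec (StateIdx nz ny)}
    {η : Vec (Fin ny)} (hy : y ∈ (P.errorSystem L H T₁ T₂).jumpMap x η) :
    storage P₁ P₂ δ y ≤ storage P₁ P₂ δ x + Real.exp (δ * T₂) * ‖mulVL P₂‖ * ‖η‖ ^ 2 := by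
  have hε : epsPart y = epsPart x := by
    rw [epsPart, errPart_of_mem_jumpMap hy, stack_first]
  have hθ : thetaPart y = -η := by
    rw [thetaPart, errPart_of_mem_jumpMap hy, stack_second]
  obtain ⟨c, hc, hle⟩ := exists_pos_mul_norm_sq_le_inner_mulV hP₂
  have hx : 0 ≤ Real.exp (δ * timer x) * inner ℝ (thetaPart x) (mulV P₂ (thetaPart x)) :=
    mul_nonneg (Real.exp_nonneg _) (le_trans (by positivity) (hle _))
  have hη : Real.exp (δ * timer y) * inner ℝ (-η) (mulV P₂ (-η)) ≤
      Real.exp (δ * T₂) * ‖mulVL P₂‖ * ‖η‖ ^ 2 := by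
    rw [mul_assoc, ← norm_neg η]
    refine (mul_le_mul_of_nonneg_left (inner_mulV_self_le _ _) (Real.exp_nonneg _)).trans ?_
    gcongr
    exact (timer_of_mem_jumpMap hy).2
  rw [storage, storage, hε, hθ]
  linarith

theorem exists_isStorage (hψ : ∀ v₁ v₂, ‖P.ψ v₁ - P.ψ v₂‖ ≤ ell * ‖v₁ - v₂‖)
    (hP₁ : P₁.PosDef) (hP₂ : P₂.PosDef) (hδ : 0 ≤ δ) (hχ : 0 ≤ χ)
    (hM₀ : (-P.calMred lamt ell P₁ P₂ δ χ L H 0).PosDef)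
    (hMT : (-P.calMred lamt ell P₁ P₂ δ χ L H T₂).PosDef) :
    ∃ γ > (0 : ℝ), ∃ q ≥ (0 : ℝ), ∃ c₁ > (0 : ℝ), ∃ c₂ > (0 : ℝ),
      (P.errorSystem L H T₁ T₂).IsStorage (attractor nz ny T₂) P.perfOutput (storage P₁ P₂ δ)
        lamt γ q c₁ c₂ := by
  obtain ⟨γ, hγ, hflow⟩ := exists_fderiv_storage_flowMap_le (T₁ := T₁) hψ
    (Matrix.isHermitian_iff_isSymm.1 hP₁.isHermitian)
    (Matrix.isHermitian_iff_isSymm.1 hP₂.isHermitian) hδ hχ hM₀ hMT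
  obtain ⟨c₁, hc₁, hlower⟩ := exists_mul_norm_errPart_sq_le_storage hP₁ hP₂ hδ
  obtain ⟨c₂, hc₂, hupper⟩ := exists_storage_le_mul_norm_errPart_sq P₁ P₂ hδ T₂
  exact ⟨γ, hγ, Real.exp (δ * T₂) * ‖mulVL P₂‖, by positivity, c₁, hc₁, c₂, hc₂,
    { contDiff := contDiff_storage
      lower := fun x hx => by
        rw [infDist_attractor hx]
        exact hlower x hx.1
      upper := fun x hx => by
        rw [infDist_attractor hx]
        exact hupper x hx.2
      flow := hflow
      jump := fun _ _ _ _ hy => storage_le_of_mem_jumpMap hP₂ hδ hy }⟩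

end Storage

section Timer

variable {x : ℝ → Vec (StateIdx nz ny)} {v : ℝ → Vec (Fin nw ⊕ Fin ny)} {a b : ℝ}

theorem timer_eq_sub (hab : a ≤ b) (hac : AbsolutelyContinuousOnInterval x a b)
    {w : ℝ → Vec (Fin nw)} (hd : ∀ᵐ r ∂(volume.restrict (Icc a b)),
      HasDerivAt x ((P.errorSystem L H T₁ T₂).flowMap (x r) (w r)) r) :
    timer (x b) = timer (x a) - (b - a) := by
  have htimer := eq_add_mul_of_ae_hasDerivAt_const hab
    (absolutelyContinuousOnInterval_contDiff_comp (timerL nz ny).contDiff hac) (D := -1) (by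
      filter_upwards [hd] with r hr
      exact (timerL nz ny).hasFDerivAt.comp_hasDerivAt r hr)
  simp only [timerL_apply] at htimer
  linarith

theorem staysInFlowSet (hT₁ : 0 ≤ T₁) (hT₂ : 0 ≤ T₂) :
    (P.errorSystem L H T₁ T₂).StaysInFlowSet := by
  refine .of_isClosed (isClosed_Icc.preimage (timerL nz ny).continuous) (fun x hx => ?_)
    fun x _ η y hy => Icc_subset_Icc_left hT₁ (timer_of_mem_jumpMap hy)
  have hx0 : timer x = 0 := hx
  exact ⟨hx0.ge, hx0.trans_le hT₂⟩

theorem hasDwellTime : (P.errorSystem L H T₁ T₂).HasDwellTime T₁ := by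
  intro φ u hS s s' j hs hs'
  obtain ⟨t, ht⟩ := φ.isDomain.exists_isStartTimes
  have hle : s ≤ t (j + 1) := ht.le_start_of_lt j.lt_succ_self hs.1 hs.2
  have hflow := hS.isFlowPair_Icc ht hs'.1
  have hstart := timer_of_mem_jumpMap (hS.jump _ (hS.mem_jumpSet ht hs'.1).1).2
  have hend : timer (φ.val s' (j + 1)) = 0 := (hS.jump _ hs').1
  have heq := timer_eq_sub (ht.start_le hs'.1) (hflow.arc _ _ (ht.start_le hs'.1) subset_rfl)
    hflow.flow_deriv
  linarith [hstart.1]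

theorem exists_isFlowPair_of_timer_pos {K : NNReal} (hψ : LipschitzWith K P.ψ)
    {x₀ : Vec (StateIdx nz ny)} (hpos : 0 < timer x₀) (hle : timer x₀ ≤ T₂) (T : ℝ) :
    ∃ b > T, ∃ x v, x T = x₀ ∧ (P.errorSystem L H T₁ T₂).IsFlowPair (Icc T b) x v := by
  obtain ⟨K', hK'⟩ := exists_lipschitzWith_flowMap hψ L H T₁ T₂
  obtain ⟨b, hTb, hb, x, hxT, hac, hd⟩ := exists_forall_mem_Ioo_hasDerivAt_of_lipschitzWith
    (hK'.comp (LipschitzWith.prodMk_right (0 : Vec (Fin nw)))) x₀ T hpos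
  have hd' : ∀ᵐ r ∂(volume.restrict (Icc T b)),
      HasDerivAt x ((P.errorSystem L H T₁ T₂).flowMap (x r) 0) r := by
    rw [← Measure.restrict_congr_set Ioo_ae_eq_Icc]
    filter_upwards [ae_restrict_mem measurableSet_Ioo] with r hr
    exact hd r hr
  refine ⟨b, hTb, x, fun _ => 0, hxT, .of_absolutelyContinuousOnInterval (M := 0) hac
    aemeasurable_const (by simp) (fun s hs => ?_) hd'⟩
  have hsub : Icc T s ⊆ Icc T b := Icc_subset_Icc_right hs.2.le
  have hac' : AbsolutelyContinuousOnInterval x T s :=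
    hac.mono (by rwa [uIcc_of_le hs.1.le, uIcc_of_le hTb.le])
  have htimer := timer_eq_sub hs.1.le hac' (ae_restrict_of_ae_restrict_of_subset hsub hd')
  change timer (x s) ∈ Icc 0 T₂
  rw [htimer, hxT]
  constructor <;> linarith [hs.1, hs.2]

theorem isComplete_of_isMaximalPair {K : NNReal} (hψ : LipschitzWith K P.ψ) (hT₁ : 0 ≤ T₁)
    (hT₂ : T₁ ≤ T₂) {φ : HybridSignal (Vec (StateIdx nz ny))}
    {u : HybridSignal (Vec (Fin nw ⊕ Fin ny))}
    (hφ : (P.errorSystem L H T₁ T₂).IsMaximalPair φ u) : φ.IsComplete := by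
  obtain ⟨K', hK'⟩ := exists_lipschitzWith_flowMap hψ L H T₁ T₂
  refine hφ.isComplete hK' fun T j hT => ?_
  have hmem := staysInFlowSet hT₁ (hT₁.trans hT₂) φ u hφ.1 T j hT
  rcases hmem.1.eq_or_lt with hzero | hpos
  · exact .inl ⟨hzero.symm, fun _ => ⟨_, T₁, ⟨le_rfl, hT₂⟩, rfl⟩⟩
  · exact .inr ⟨hmem, exists_isFlowPair_of_timer_pos hψ hpos hmem.2 T⟩

end Timer

end Plant

end SporadicObs

theorem corollary1 {nz ny nw nq ns np : ℕ} (P : SporadicObs.Plant nz ny nw nq ns np)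
    (ell : ℝ) (hell : 0 < ell) (hψ : ∀ v₁ v₂, ‖P.ψ v₁ - P.ψ v₂‖ ≤ ell * ‖v₁ - v₂‖)
    (T₁ T₂ : ℝ) (hT₁ : 0 < T₁) (hT₂ : T₁ ≤ T₂)
    (lamt : ℝ) (hlamt : 0 < lamt)
    (P₁ : Matrix (Fin nz) (Fin nz) ℝ) (hP₁ : P₁.PosDef)
    (P₂ : Matrix (Fin ny) (Fin ny) ℝ) (hP₂ : P₂.PosDef)
    (δ χ : ℝ) (hδ : 0 < δ) (hχ : 0 < χ)
    (L : Matrix (Fin nz) (Fin ny) ℝ) (H : Matrix (Fin ny) (Fin ny) ℝ)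
    (hM₀ : (-P.calMred lamt ell P₁ P₂ δ χ L H 0).PosDef)
    (hMT : (-P.calMred lamt ell P₁ P₂ δ χ L H T₂).PosDef) :
    ∃ γ > (0 : ℝ),
      (P.errorSystem L H T₁ T₂).IsEISS (SporadicObs.Plant.attractor nz ny T₂) ∧
        P.HasL2Gain L H T₁ T₂ γ := by
  have hlip : LipschitzWith ell.toNNReal P.ψ := .of_dist_le' fun v₁ v₂ => by
    simpa only [dist_eq_norm] using hψ v₁ v₂
  have hflow := P.staysInFlowSet (L := L) (H := H) hT₁.le (hT₁.le.trans hT₂)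
  obtain ⟨γ, hγ, q, hq, c₁, hc₁, c₂, hc₂, hV⟩ :=
    SporadicObs.Plant.exists_isStorage (T₁ := T₁) hψ hP₁ hP₂ hδ.le hχ.le hM₀ hMT
  have hpre := hV.isPreEISS hlamt hq hc₁ hc₂ hT₁ SporadicObs.Plant.hasDwellTime hflow
  have hcomplete := fun φ u => SporadicObs.Plant.isComplete_of_isMaximalPair
    (L := L) (H := H) (φ := φ) (u := u) hlip hT₁.le hT₂
  refine ⟨γ, hγ, ⟨hpre, hcomplete⟩, √c₂, Real.sqrt_pos.2 hc₂, fun φ u hS hη => ?_⟩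
  exact hV.l2Norm_le hlamt.le hc₁.le hc₂.le hγ.le
    ((SporadicObs.mulVL P.Cp).comp (SporadicObs.epsL nz ny)).continuous hflow hS hη
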